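/- Let $n \ge 1$ be an integer, let $\mathbb{RP}^n$ be the real projective space of lines through the origin in $\mathbb{R}^{n+1}$ with its quotient topology, and let $\mathbb{RP}^{n-1} \subseteq \mathbb{RP}^n$ be the set of lines contained in the hyperplane $\mathbb{R}^n \times \{0\}$. (i) If $n$ is odd, if $f, g \colon \mathbb{RP}^n \to \mathbb{RP}^n$ are continuous and freely homotopic, and if $f(a) = g(a)$ for a point $a \in \mathbb{RP}^n$, then $f$ and $g$ are homotopic relatively to $\{a\}$, that is, there is a continuous $H \colon [0,1] \times \mathbb{RP}^n \to \mathbb{RP}^n$ with $H(0,\cdot) = f$, $H(1,\cdot) = g$ and $H(t,a) = f(a)$ for every $t \in [0,1]$. (ii) If $n$ is even, then for every $a \in \mathbb{RP}^{n-1}$ there exist continuous maps $f, g \colon \mathbb{RP}^n \to \mathbb{RP}^n$ such that $f = g$ on $\mathbb{RP}^{n-1}$ and $f$ and $g$ are freely homotopic, but $f$ and $g$ are not homotopic relatively to $\{a\}$. -/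

import Mathlib

open scoped LinearAlgebra.Projectivization

/-- The quotient topology on the projectivization of a topological vector space `V`, induced by
the canonical map `v ↦ [v]` from `V ∖ {0}` with its subspace topology. -/
instance Projectivization.quotientTopology (K V : Type*) [DivisionRing K] [AddCommGroup V]
    [Module K V] [TopologicalSpace V] : TopologicalSpace (ℙ K V) :=
  inferInstanceAs (TopologicalSpace (Quotient (projectivizationSetoid K V)))

/-- The real projective space `ℝPⁿ`: lines through the origin in `ℝⁿ⁺¹`. -/
abbrev RealProjectiveSpace (n : ℕ) : Type :=
  ℙ ℝ (EuclideanSpace ℝ (Fin (n + 1)))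

/-- The standard copy of `ℝPⁿ⁻¹` inside `ℝPⁿ` (for `n ≥ 1`): the lines contained in the
hyperplane `ℝⁿ × {0}` of `ℝⁿ⁺¹`, on which the last coordinate vanishes. -/
def RealProjectiveSpace.hyperplane (n : ℕ) : Set (RealProjectiveSpace n) :=
  {p | ∀ v ∈ p.submodule, v (Fin.last n) = 0}

/-- In homogeneous coordinates, `[v]` lies in `ℝPⁿ⁻¹` iff the last coordinate of `v` is zero. -/
theorem RealProjectiveSpace.mk_mem_hyperplane {n : ℕ} (v : EuclideanSpace ℝ (Fin (n + 1)))
    (hv : v ≠ 0) :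
    (Projectivization.mk ℝ v hv : RealProjectiveSpace n) ∈ hyperplane n ↔
      v (Fin.last n) = 0 := by
  simp only [hyperplane, Set.mem_ofPred_eq, Projectivization.submodule_mk]
  constructor
  · intro h
    exact h v (Submodule.mem_span_singleton_self v)
  · intro h w hw
    obtain ⟨c, rfl⟩ := Submodule.mem_span_singleton.1 hw
    simp [h]

/-! Write `E` for ℝⁿ⁺¹; its unit sphere is a double cover of ℝPⁿ, and an isometry and its negative
induce the same map of ℝPⁿ.

(i) Lift the track of `a` under the free homotopy to a path `γ` on the sphere. Composing each stage
of the homotopy with a rotation that carries the moved base point back gives `f` ≃ `A` ∘ `g`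
relative to `a`, where `A` has determinant 1 and `A (γ 1) = γ 0 = ± γ 1`. For n odd, -1 has
determinant 1 on `E`, so `A` or `-A` is a rotation fixing `γ 1`. Such a rotation deforms to the
identity through isometries fixing `γ 1` (`projectiveMap_homotopicRel_id`). The two steps are
`exists_isometry_timeSlice_homotopicRel` and `ContinuousMap.Homotopic.homotopicRel_of_even_finrank`.

(ii) Take the identity and the reflection in the last coordinate `e`. For n even the negative of
this reflection is a rotation fixing `e`, so the two maps are freely homotopic. A homotopy relative
to a point `a` of the mirror would lift to a homotopy on the sphere from the identity to the
reflection itself, which is impossible because their degrees are 1 and -1.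

The degree argument is combinatorial (`not_homotopy_id_swap`). After conjugation the reflection
swaps two coordinates and the fixed point is a pole. The homotopy is pulled back to a prism, the
interval times a cube whose walls collapse to the pole, with its Kuhn triangulation. Vertices are
labelled by regions of the sphere, and the fully labelled simplices of a facet are counted with
signs as in Sperner's lemma. If no simplex of the prism carried all labels, the counts on the two
end facets would agree; but they are 1 and -1. A fine mesh forbids such a simplex, since no point of
the sphere lies in all the closed label regions. -/

/-! ### The double cover of projective space by the sphere, and maps induced by isometries. -/

section ProjectiveCovering

open Topology unitInterval Module

variable {E : Type*} [NormedAddCommGroup E] [InnerProductSpace ℝ E]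

/-- The sign action of `{±1}` on the unit sphere. -/
@[reducible]
def unitSphereSignAction (E : Type*) [NormedAddCommGroup E] [InnerProductSpace ℝ E] :
    MulAction ℤˣ (Metric.sphere (0 : E) 1) where
  smul u v := ⟨(u : ℤ) • (v : E), by
    rcases Int.units_eq_one_or u with rfl | rfl <;> simp⟩
  one_smul v := Subtype.ext (by change ((1 : ℤˣ) : ℤ) • (v : E) = v; simp)
  mul_smul u w v := Subtype.ext (by
    change ((u * w : ℤˣ) : ℤ) • (v : E) = (u : ℤ) • (w : ℤ) • (v : E)
    rw [Units.val_mul, mul_smul])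

/-- The map from the unit sphere to projective space. -/
noncomputable def sphereToProjective (E : Type*) [NormedAddCommGroup E] [InnerProductSpace ℝ E]
    (v : Metric.sphere (0 : E) 1) : ℙ ℝ E :=
  Projectivization.mk ℝ (v : E) (ne_zero_of_mem_unit_sphere v)

theorem Projectivization.isQuotientMap_mk' (K V : Type*) [DivisionRing K] [AddCommGroup V]
    [Module K V] [TopologicalSpace V] : IsQuotientMap (Projectivization.mk' K (V := V)) :=
  isQuotientMap_quotient_mk'

theorem continuous_sphereToProjective : Continuous (sphereToProjective E) :=
  (Projectivization.isQuotientMap_mk' ℝ E).continuous.comp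
    (continuous_subtype_val.subtype_mk fun v => ne_zero_of_mem_unit_sphere v)

theorem isQuotientMap_sphereToProjective : IsQuotientMap (sphereToProjective E) := by
  let r : {v : E // v ≠ 0} → Metric.sphere (0 : E) 1 := fun v =>
    ⟨‖(v : E)‖⁻¹ • (v : E), by
      have := norm_ne_zero_iff.2 v.2
      simp [norm_smul, this]⟩
  have hr : Continuous r := by
    refine Continuous.subtype_mk (Continuous.smul (Continuous.inv₀ (by fun_prop) ?_) (by fun_prop)) _
    exact fun v => norm_ne_zero_iff.2 v.2
  refine IsQuotientMap.of_comp hr continuous_sphereToProjective ?_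
  have : sphereToProjective E ∘ r = Projectivization.mk' ℝ := by
    funext v
    exact (Projectivization.mk_eq_mk_iff' ℝ _ _ _ _).2 ⟨_, rfl⟩
  rw [this]
  exact Projectivization.isQuotientMap_mk' ℝ E

theorem sphereToProjective_eq_iff {v w : Metric.sphere (0 : E) 1} :
    sphereToProjective E v = sphereToProjective E w ↔ (v : E) = w ∨ (v : E) = -w := by
  constructor
  · intro h
    obtain ⟨c, hc⟩ := (Projectivization.mk_eq_mk_iff' ℝ _ _ _ _).1 h
    have h1 : |c| = 1 := by
      have := congrArg norm hc
      simpa [norm_smul] using this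
    rcases (abs_eq zero_le_one).1 h1 with rfl | rfl
    · left; simpa using hc.symm
    · right; simpa using hc.symm
  · rintro (h | h)
    · exact (Projectivization.mk_eq_mk_iff' ℝ _ _ _ _).2 ⟨1, by simp [h]⟩
    · exact (Projectivization.mk_eq_mk_iff' ℝ _ _ _ _).2 ⟨-1, by simp [h]⟩

theorem isQuotientCoveringMap_sphereToProjective :
    letI := unitSphereSignAction E
    IsQuotientCoveringMap (sphereToProjective E) ℤˣ := by
  let := unitSphereSignAction E
  have hs : ∀ (u : ℤˣ) (v : Metric.sphere (0 : E) 1), ((u • v : Metric.sphere (0 : E) 1) : E)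
      = (u : ℤ) • (v : E) := fun _ _ => rfl
  refine { isQuotientMap_sphereToProjective with
    continuous_const_smul := fun u => ?_
    apply_eq_iff_mem_orbit := ?_
    disjoint := fun e => ?_ }
  · exact Continuous.subtype_mk (continuous_subtype_val.const_smul (u : ℤ)) _
  · intro v w
    rw [sphereToProjective_eq_iff]
    constructor
    · rintro (h | h)
      · exact ⟨1, Subtype.ext (by simp [h])⟩
      · exact ⟨-1, Subtype.ext (by simp [hs, h])⟩
    · rintro ⟨u, hu⟩
      have := congrArg Subtype.val hu
      rcases Int.units_eq_one_or u with rfl | rfl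
      · left; simpa using this.symm
      · right; simpa [hs] using this.symm
  -- Antipodal unit vectors are at distance 2, so they cannot both lie in a ball of radius 1.
  · refine ⟨Metric.ball e 1, Metric.ball_mem_nhds e one_pos, fun u hu => ?_⟩
    obtain ⟨_, ⟨x, hx, rfl⟩, hy⟩ := hu
    rcases Int.units_eq_one_or u with rfl | rfl
    · rfl
    · exfalso
      rw [Metric.mem_ball, Subtype.dist_eq, dist_eq_norm] at hx hy
      have h2 : ‖(2 : ℝ) • (x : E)‖ < 2 := by
        calc ‖(2 : ℝ) • (x : E)‖ = ‖((x : E) - e) - (((-1 : ℤˣ) • x : Metric.sphere (0 : E) 1) - e)‖ := by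
              congr 1; rw [hs, two_smul]; simp
          _ ≤ _ := norm_sub_le _ _
          _ < 2 := by linarith
      rw [norm_smul] at h2
      simp at h2

theorem isCoveringMap_sphereToProjective : IsCoveringMap (sphereToProjective E) := by
  let := unitSphereSignAction E
  exact isQuotientCoveringMap_sphereToProjective.isCoveringMap

theorem isOpenQuotientMap_sphereToProjective : IsOpenQuotientMap (sphereToProjective E) := by
  let := unitSphereSignAction E
  exact isQuotientCoveringMap_sphereToProjective.isOpenQuotientMap

theorem exists_sphereToProjective_eq (p : ℙ ℝ E) : ∃ v, sphereToProjective E v = p :=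
  isQuotientMap_sphereToProjective.surjective p

theorem sphereToProjective_ind {P : ℙ ℝ E → Prop} (h : ∀ v, P (sphereToProjective E v)) (p : ℙ ℝ E) :
    P p := by
  obtain ⟨v, rfl⟩ := exists_sphereToProjective_eq p
  exact h v

/-- The image of a point of the unit sphere under a linear isometry. -/
def LinearIsometryEquiv.sphereMap (A : E ≃ₗᵢ[ℝ] E) (v : Metric.sphere (0 : E) 1) :
    Metric.sphere (0 : E) 1 :=
  ⟨A v, by simp⟩

/-- The self-map of projective space induced by a linear isometry. -/
noncomputable def LinearIsometryEquiv.projectiveFun (A : E ≃ₗᵢ[ℝ] E) (p : ℙ ℝ E) : ℙ ℝ E :=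
  Projectivization.map A.toLinearEquiv.toLinearMap A.injective p

@[simp]
theorem LinearIsometryEquiv.projectiveFun_sphereToProjective (A : E ≃ₗᵢ[ℝ] E)
    (v : Metric.sphere (0 : E) 1) :
    A.projectiveFun (sphereToProjective E v) = sphereToProjective E (A.sphereMap v) :=
  rfl

theorem continuous_projectiveFun_family {T : Type*} [TopologicalSpace T] {A : T → E ≃ₗᵢ[ℝ] E}
    (hA : Continuous fun q : T × E => A q.1 q.2) :
    Continuous fun q : T × ℙ ℝ E => (A q.1).projectiveFun q.2 := by
  have hq := (IsOpenQuotientMap.id (X := T)).prodMap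
    (isOpenQuotientMap_sphereToProjective (E := E))
  refine hq.isQuotientMap.continuous_iff.2 ?_
  refine continuous_sphereToProjective.comp (g := sphereToProjective E)
    (f := fun q : T × Metric.sphere (0 : E) 1 => (A q.1).sphereMap q.2) ?_
  exact Continuous.subtype_mk
    (hA.comp (continuous_fst.prodMk (continuous_subtype_val.comp continuous_snd))) _

/-- The continuous self-map of projective space induced by a linear isometry. -/
noncomputable def LinearIsometryEquiv.projectiveMap (A : E ≃ₗᵢ[ℝ] E) : C(ℙ ℝ E, ℙ ℝ E) where
  toFun := A.projectiveFun
  continuous_toFun :=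
    (continuous_projectiveFun_family (T := Unit) (A := fun _ => A)
      (A.continuous.comp continuous_snd)).comp (Continuous.prodMk_right ())

@[simp]
theorem LinearIsometryEquiv.projectiveMap_sphereToProjective (A : E ≃ₗᵢ[ℝ] E)
    (v : Metric.sphere (0 : E) 1) :
    A.projectiveMap (sphereToProjective E v) = sphereToProjective E (A.sphereMap v) :=
  rfl

theorem LinearIsometryEquiv.projectiveMap_one :
    (1 : E ≃ₗᵢ[ℝ] E).projectiveMap = ContinuousMap.id _ :=
  ContinuousMap.ext (sphereToProjective_ind fun _ => rfl)

theorem LinearIsometryEquiv.projectiveMap_mul (A B : E ≃ₗᵢ[ℝ] E) :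
    (A * B).projectiveMap = A.projectiveMap.comp B.projectiveMap :=
  ContinuousMap.ext (sphereToProjective_ind fun _ => rfl)

theorem LinearIsometryEquiv.projectiveMap_neg (A : E ≃ₗᵢ[ℝ] E) :
    (LinearIsometryEquiv.neg ℝ * A).projectiveMap = A.projectiveMap :=
  ContinuousMap.ext (sphereToProjective_ind fun v => by
    rw [projectiveMap_sphereToProjective, projectiveMap_sphereToProjective,
      sphereToProjective_eq_iff]
    exact Or.inr rfl)

theorem homotopicRel_of_isometry_family {X : Type*} [TopologicalSpace X]
    (A : I → E ≃ₗᵢ[ℝ] E) (hA : Continuous fun q : I × E => A q.1 q.2)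
    (H : C(I × X, ℙ ℝ E)) (f g : C(X, ℙ ℝ E)) (S : Set X)
    (h0 : ∀ x, (A 0).projectiveFun (H (0, x)) = f x)
    (h1 : ∀ x, (A 1).projectiveFun (H (1, x)) = g x)
    (hS : ∀ t, ∀ x ∈ S, (A t).projectiveFun (H (t, x)) = f x) :
    f.HomotopicRel g S :=
  ⟨⟨⟨⟨fun q => (A q.1).projectiveFun (H q),
    (continuous_projectiveFun_family hA).comp (continuous_fst.prodMk H.continuous)⟩, h0, h1⟩, hS⟩⟩

theorem projectiveMap_homotopicRel (A : I → E ≃ₗᵢ[ℝ] E)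
    (hA : Continuous fun q : I × E => A q.1 q.2) (S : Set (ℙ ℝ E))
    (hS : ∀ t, ∀ p ∈ S, (A t).projectiveFun p = (A 0).projectiveFun p) :
    (A 0).projectiveMap.HomotopicRel (A 1).projectiveMap S :=
  homotopicRel_of_isometry_family A hA ⟨Prod.snd, continuous_snd⟩ _ _ _
    (fun _ => rfl) (fun _ => rfl) hS

theorem ContinuousMap.HomotopicRel.precomp {X Y Z : Type*} [TopologicalSpace X] [TopologicalSpace Y]
    [TopologicalSpace Z] {f g : C(Y, Z)} {S : Set Y} (h : f.HomotopicRel g S) (k : C(X, Y))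
    {R : Set X} (hk : ∀ x ∈ R, k x ∈ S) : (f.comp k).HomotopicRel (g.comp k) R := by
  obtain ⟨F⟩ := h
  exact ⟨⟨⟨⟨fun q => F (q.1, k q.2), by fun_prop⟩, fun x => by simp, fun x => by simp⟩,
    fun t x hx => F.eq_fst t (hk x hx)⟩⟩

end ProjectiveCovering

/-! ### Deforming rotations that fix a vector to the identity. -/

section Reflections

open Topology unitInterval Module

variable {E : Type*} [NormedAddCommGroup E] [InnerProductSpace ℝ E]

/-- The reflection in the hyperplane orthogonal to `w`. -/
noncomputable abbrev hyperplaneReflection (w : E) : E ≃ₗᵢ[ℝ] E :=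
  (ℝ ∙ w)ᗮ.reflection

theorem hyperplaneReflection_apply (w v : E) :
    hyperplaneReflection w v = v - (2 * (inner ℝ w v / ‖w‖ ^ 2)) • w := by
  rw [hyperplaneReflection, Submodule.reflection_orthogonal_apply,
    Submodule.reflection_singleton_apply]
  simp only [RCLike.ofReal_real_eq_id, id_eq, two_smul, neg_sub, two_mul, add_smul]

theorem LinearIsometryEquiv.mul_apply (A B : E ≃ₗᵢ[ℝ] E) (v : E) : (A * B) v = A (B v) :=
  rfl

theorem hyperplaneReflection_mul_self (w : E) :
    hyperplaneReflection w * hyperplaneReflection w = 1 := by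
  ext v
  rw [LinearIsometryEquiv.mul_apply, Submodule.reflection_reflection]
  rfl

theorem hyperplaneReflection_of_inner_eq_zero {w v : E} (h : inner ℝ w v = 0) :
    hyperplaneReflection w v = v := by
  simp [hyperplaneReflection_apply, h]

theorem hyperplaneReflection_neg (w : E) : hyperplaneReflection (-w) = hyperplaneReflection w := by
  ext v
  simp [hyperplaneReflection_apply, neg_div]

theorem hyperplaneReflection_zero : hyperplaneReflection (0 : E) = 1 := by
  ext v
  simp [hyperplaneReflection_apply]

theorem continuous_hyperplaneReflection {T : Type*} [TopologicalSpace T] {w v : T → E}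
    (hw : Continuous w) (hv : Continuous v) (h0 : ∀ t, w t ≠ 0) :
    Continuous fun t => hyperplaneReflection (w t) (v t) := by
  simp_rw [hyperplaneReflection_apply]
  refine hv.sub (Continuous.smul (continuous_const.mul (Continuous.div (by fun_prop) (by fun_prop)
    fun t => ?_)) hw)
  exact pow_ne_zero 2 (norm_ne_zero_iff.2 (h0 t))

/-- The determinant of a linear isometry. -/
noncomputable abbrev LinearIsometryEquiv.detReal (A : E ≃ₗᵢ[ℝ] E) : ℝ :=
  LinearMap.det A.toLinearEquiv.toLinearMap

theorem LinearIsometryEquiv.detReal_mul (A B : E ≃ₗᵢ[ℝ] E) :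
    (A * B).detReal = A.detReal * B.detReal :=
  LinearMap.det_comp A.toLinearEquiv.toLinearMap B.toLinearEquiv.toLinearMap

theorem LinearIsometryEquiv.detReal_one : (1 : E ≃ₗᵢ[ℝ] E).detReal = 1 :=
  LinearMap.det_id

theorem LinearIsometryEquiv.detReal_neg :
    (LinearIsometryEquiv.neg ℝ : E ≃ₗᵢ[ℝ] E).detReal = (-1) ^ finrank ℝ E := by
  have : (LinearIsometryEquiv.neg ℝ : E ≃ₗᵢ[ℝ] E).toLinearEquiv.toLinearMap
    = (-1 : ℝ) • LinearMap.id := by ext; simp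
  rw [detReal, this, LinearMap.det_smul, LinearMap.det_id, mul_one]

/-- Slide the normal `w` to `u` along a segment inside the orthogonal complement of `x`: every
intermediate product fixes `x`, and the last one is the square of a reflection. -/
theorem projectiveMap_reflection_mul_homotopicRel {u w x : E} (hx : x ≠ 0) (hu : u ≠ 0)
    (hw : w ≠ 0) (hux : inner ℝ u x = 0) (hwx : inner ℝ w x = 0) :
    (hyperplaneReflection u * hyperplaneReflection w).projectiveMap.HomotopicRel
      (ContinuousMap.id _) {Projectivization.mk ℝ x hx} := by
  -- The reflection does not see the sign of its normal; with a nonnegative inner product the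
  -- segment from `w` to `u` avoids zero.
  wlog huw : 0 ≤ inner ℝ u w generalizing w
  · have := this (w := -w) (neg_ne_zero.2 hw) (by simp [hwx])
      (by rw [inner_neg_right]; linarith)
    rwa [hyperplaneReflection_neg] at this
  let z : I → E := fun t => (1 - (t : ℝ)) • w + (t : ℝ) • u
  have hz : ∀ t, z t ≠ 0 := by
    intro t ht
    have h1 : inner ℝ (z t) w = 0 := by rw [ht, inner_zero_left]
    have h2 : inner ℝ (z t) u = 0 := by rw [ht, inner_zero_left]
    simp only [z, inner_add_left, inner_smul_left, real_inner_self_eq_norm_sq,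
      RCLike.conj_to_real] at h1 h2
    rw [real_inner_comm] at h2
    have hw' := norm_pos_iff.2 hw
    have hu' := norm_pos_iff.2 hu
    have ht0 := t.2.1
    have ht1 := t.2.2
    have e1 : (1 - (t : ℝ)) * ‖w‖ ^ 2 = 0 := by
      have a := mul_nonneg (sub_nonneg.2 ht1) (sq_nonneg ‖w‖)
      have b := mul_nonneg ht0 huw
      linarith
    have e2 : (t : ℝ) * ‖u‖ ^ 2 = 0 := by
      have a := mul_nonneg ht0 (sq_nonneg ‖u‖)
      have b := mul_nonneg (sub_nonneg.2 ht1) huw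
      linarith
    rcases mul_eq_zero.1 e1 with h | h
    · rcases mul_eq_zero.1 e2 with h' | h'
      · linarith
      · exact (pow_ne_zero 2 hu'.ne') h'
    · exact (pow_ne_zero 2 hw'.ne') h
  have hzx : ∀ t, inner ℝ (z t) x = 0 := fun t => by
    simp [z, inner_add_left, inner_smul_left, hux, hwx]
  have key := projectiveMap_homotopicRel
    (fun t => hyperplaneReflection u * hyperplaneReflection (z t)) (by
      refine (hyperplaneReflection u).continuous.comp
        (continuous_hyperplaneReflection (w := fun q : I × E => z q.1) ?_ continuous_snd
          fun q => hz q.1)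
      fun_prop) {Projectivization.mk ℝ x hx} (by
      rintro t p rfl
      have : ∀ t, (hyperplaneReflection u * hyperplaneReflection (z t)) x = x := fun t => by
        rw [LinearIsometryEquiv.mul_apply, hyperplaneReflection_of_inner_eq_zero (hzx t),
          hyperplaneReflection_of_inner_eq_zero hux]
      refine (Projectivization.mk_eq_mk_iff' ℝ _ _ _ _).2 ⟨1, ?_⟩
      exact (one_smul ℝ _).trans ((this 0).trans (this t).symm))
  have e0 : z 0 = w := by simp [z]
  have e1 : z 1 = u := by simp [z]
  rwa [e0, e1, hyperplaneReflection_mul_self, LinearIsometryEquiv.projectiveMap_one] at key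

theorem projectiveMap_mul_homotopicRel {A B B' : E ≃ₗᵢ[ℝ] E} {S : Set (ℙ ℝ E)}
    (h : B.projectiveMap.HomotopicRel B'.projectiveMap S) :
    (A * B).projectiveMap.HomotopicRel (A * B').projectiveMap S := by
  rw [LinearIsometryEquiv.projectiveMap_mul, LinearIsometryEquiv.projectiveMap_mul]
  exact h.comp_continuousMap A.projectiveMap

variable [FiniteDimensional ℝ E]

theorem detReal_hyperplaneReflection {w : E} (hw : w ≠ 0) :
    (hyperplaneReflection w).detReal = -1 := by
  have h := (ℝ ∙ w)ᗮ.det_reflection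
  rw [Submodule.orthogonal_orthogonal, finrank_span_singleton hw, pow_one] at h
  exact h

/-- Reflections cancel in pairs up to homotopy, so only the parity of the number of nonzero normals
survives, and the determinant records it. -/
theorem projectiveMap_list_prod_homotopicRel {x : E} (hx : x ≠ 0) (l : List E)
    (hl : ∀ w ∈ l, inner ℝ w x = 0) :
    ((l.map hyperplaneReflection).prod.detReal = 1 ∧
      (l.map hyperplaneReflection).prod.projectiveMap.HomotopicRel
        (1 : E ≃ₗᵢ[ℝ] E).projectiveMap {Projectivization.mk ℝ x hx}) ∨
    ((l.map hyperplaneReflection).prod.detReal = -1 ∧ ∃ w : E, w ≠ 0 ∧ inner ℝ w x = 0 ∧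
      (l.map hyperplaneReflection).prod.projectiveMap.HomotopicRel
        (hyperplaneReflection w).projectiveMap {Projectivization.mk ℝ x hx}) := by
  induction l with
  | nil => exact Or.inl ⟨LinearIsometryEquiv.detReal_one, ContinuousMap.HomotopicRel.refl _⟩
  | cons u l ih =>
    have ih := ih fun w hw => hl w (List.mem_cons_of_mem _ hw)
    have hux : inner ℝ u x = 0 := hl u List.mem_cons_self
    rw [List.map_cons, List.prod_cons]
    by_cases hu : u = 0
    · rwa [hu, hyperplaneReflection_zero, one_mul]
    rw [LinearIsometryEquiv.detReal_mul, detReal_hyperplaneReflection hu]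
    rcases ih with ⟨hd, h⟩ | ⟨hd, w, hw, hwx, h⟩
    · right
      refine ⟨by rw [hd, mul_one], u, hu, hux, ?_⟩
      simpa using projectiveMap_mul_homotopicRel (A := hyperplaneReflection u) h
    · left
      refine ⟨by rw [hd]; norm_num, ?_⟩
      refine (projectiveMap_mul_homotopicRel (A := hyperplaneReflection u) h).trans ?_
      rw [LinearIsometryEquiv.projectiveMap_one]
      exact projectiveMap_reflection_mul_homotopicRel hx hu hw hux hwx

/-- Cartan–Dieudonné applied to the restriction of `A` to the orthogonal complement of `x`; the
resulting normals, viewed in `E`, define reflections that fix `x`. -/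
theorem exists_reflections_fixing {x : E} (A : E ≃ₗᵢ[ℝ] E) (hA : A x = x) :
    ∃ l : List E, (∀ w ∈ l, inner ℝ w x = 0) ∧ A = (l.map hyperplaneReflection).prod := by
  have hmem : ∀ v ∈ (ℝ ∙ x)ᗮ, A v ∈ (ℝ ∙ x)ᗮ := fun v hv => by
    rw [Submodule.mem_orthogonal_singleton_iff_inner_right] at hv ⊢
    rw [← hA, LinearIsometryEquiv.inner_map_map, hv]
  let B₀ : (ℝ ∙ x)ᗮ →ₗᵢ[ℝ] (ℝ ∙ x)ᗮ :=
    ⟨A.toLinearEquiv.toLinearMap.restrict hmem, fun v => A.norm_map v⟩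
  let B : (ℝ ∙ x)ᗮ ≃ₗᵢ[ℝ] (ℝ ∙ x)ᗮ := B₀.toLinearIsometryEquiv rfl
  obtain ⟨l, -, hl⟩ := B.reflections_generate_dim
  have hl' : ∀ v : (ℝ ∙ x)ᗮ, (((l.map fun w => (ℝ ∙ w)ᗮ.reflection).prod v : (ℝ ∙ x)ᗮ) : E)
      = ((l.map Subtype.val).map hyperplaneReflection).prod (v : E) := by
    clear hl
    induction l with
    | nil => intro v; rfl
    | cons w l ih =>
      intro v
      simp only [List.map_cons, List.prod_cons, LinearIsometryEquiv.mul_apply]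
      rw [← ih v]
      generalize (List.map (fun w => (ℝ ∙ w)ᗮ.reflection) l).prod v = u
      change ((hyperplaneReflection w u : (ℝ ∙ x)ᗮ) : E) = _
      rw [hyperplaneReflection_apply, hyperplaneReflection_apply]
      simp
  have hperp : ∀ w ∈ l.map Subtype.val, inner ℝ w x = 0 := by
    intro w hw
    obtain ⟨w, -, rfl⟩ := List.mem_map.1 hw
    exact Submodule.mem_orthogonal_singleton_iff_inner_left.1 w.2
  have hfix : ((l.map Subtype.val).map hyperplaneReflection).prod x = x := by
    generalize l.map Subtype.val = L at hperp
    induction L with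
    | nil => rfl
    | cons w L ih =>
      simp only [List.map_cons, List.prod_cons, LinearIsometryEquiv.mul_apply]
      rw [ih fun w hw => hperp w (List.mem_cons_of_mem _ hw)]
      exact hyperplaneReflection_of_inner_eq_zero (hperp w List.mem_cons_self)
  refine ⟨l.map Subtype.val, hperp, ?_⟩
  ext v
  obtain ⟨y, hy, z, hz, rfl⟩ := (ℝ ∙ x).exists_add_mem_mem_orthogonal v
  obtain ⟨c, rfl⟩ := Submodule.mem_span_singleton.1 hy
  rw [map_add, map_add, map_smul, map_smul, hA, hfix, ← hl' ⟨z, hz⟩, ← hl]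
  rfl

theorem projectiveMap_homotopicRel_id {x : E} (hx : x ≠ 0) (A : E ≃ₗᵢ[ℝ] E) (hA : A x = x)
    (hdet : A.detReal = 1) :
    A.projectiveMap.HomotopicRel (ContinuousMap.id _) {Projectivization.mk ℝ x hx} := by
  obtain ⟨l, hl, rfl⟩ := exists_reflections_fixing A hA
  rcases projectiveMap_list_prod_homotopicRel hx l hl with ⟨-, h⟩ | ⟨h, -⟩
  · rwa [LinearIsometryEquiv.projectiveMap_one] at h
  · rw [hdet] at h; norm_num at h

end Reflections

/-! ### From free to relative homotopies when the ambient dimension is even. -/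

section OddDimensional

open Topology unitInterval Module

variable {E : Type*} [NormedAddCommGroup E] [InnerProductSpace ℝ E]

/-- For non-antipodal unit vectors `u`, `v`, a product of two reflections taking `u` to `v`. -/
noncomputable def sphereRotation (u v : E) : E ≃ₗᵢ[ℝ] E :=
  hyperplaneReflection (u + v) * hyperplaneReflection u

theorem sphereRotation_self (u : E) : sphereRotation u u = 1 := by
  have : hyperplaneReflection (u + u) = hyperplaneReflection u := by
    ext x
    rw [hyperplaneReflection_apply, hyperplaneReflection_apply, ← two_smul ℝ u, norm_smul,
      inner_smul_left, smul_smul]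
    simp only [Real.norm_ofNat, RCLike.conj_to_real]
    congr 2
    by_cases hu : u = 0
    · simp [hu]
    · have := norm_ne_zero_iff.2 hu
      field_simp
  rw [sphereRotation, this, hyperplaneReflection_mul_self]

theorem sphereRotation_apply {u v : E} (h : ‖u‖ = ‖v‖) : sphereRotation u v u = v := by
  rw [sphereRotation, LinearIsometryEquiv.mul_apply,
    Submodule.reflection_orthogonalComplement_singleton_eq_neg, map_neg]
  -- Since `u + v = u - (-v)`, the outer reflection sends `u` to `-v`.
  have := Submodule.reflection_sub (v := u) (w := -v) (by rwa [norm_neg])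
  rw [sub_neg_eq_add] at this
  rw [this, neg_neg]

theorem continuous_sphereRotation {T : Type*} [TopologicalSpace T] {u x : T → E} {v : E}
    (hu : Continuous u) (hx : Continuous x) (h0 : ∀ t, u t ≠ 0) (h : ∀ t, u t + v ≠ 0) :
    Continuous fun t => sphereRotation (u t) v (x t) :=
  continuous_hyperplaneReflection (hu.add continuous_const)
    (continuous_hyperplaneReflection hu hx h0) h

/-- The restriction of a homotopy to a time. -/
def ContinuousMap.timeSlice {X Y : Type*} [TopologicalSpace X] [TopologicalSpace Y]
    (H : C(I × X, Y)) (t : I) : C(X, Y) :=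
  ⟨fun x => H (t, x), by fun_prop⟩

/-- At each time the rotation taking `γ (τ t)` to `γ (τ 0)` undoes the displacement of the base
point; it varies continuously as long as these two vectors are never antipodal. -/
theorem timeSlice_homotopicRel_of_segment {X : Type*} [TopologicalSpace X] (H : C(I × X, ℙ ℝ E))
    (a : X) (γ : C(I, Metric.sphere (0 : E) 1)) (hγ : ∀ t, sphereToProjective E (γ t) = H (t, a))
    (τ : C(I, I)) (h : ∀ t, (γ (τ t) : E) + γ (τ 0) ≠ 0) :
    (H.timeSlice (τ 0)).HomotopicRel
      ((sphereRotation (γ (τ 1) : E) (γ (τ 0))).projectiveMap.comp (H.timeSlice (τ 1))) {a} := by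
  refine homotopicRel_of_isometry_family (fun t => sphereRotation (γ (τ t) : E) (γ (τ 0))) ?_
    ⟨fun q => H (τ q.1, q.2), by fun_prop⟩ _ _ _ ?_ (fun _ => rfl) ?_
  · exact continuous_sphereRotation (by fun_prop) continuous_snd
      (fun q => ne_zero_of_mem_unit_sphere _) (fun q => h q.1)
  · intro x
    rw [sphereRotation_self]
    exact congrArg (fun f : C(ℙ ℝ E, ℙ ℝ E) => f (H (τ 0, x)))
      LinearIsometryEquiv.projectiveMap_one
  · rintro t x rfl
    change (sphereRotation (γ (τ t) : E) (γ (τ 0))).projectiveFun (H (τ t, x)) = H (τ 0, x)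
    rw [← hγ, ← hγ, LinearIsometryEquiv.projectiveFun_sphereToProjective]
    congr 1
    exact Subtype.ext (sphereRotation_apply (by simp))

variable [FiniteDimensional ℝ E]

theorem detReal_sphereRotation {u v : E} (hu : u ≠ 0) (h : u + v ≠ 0) :
    (sphereRotation u v).detReal = 1 := by
  rw [sphereRotation, LinearIsometryEquiv.detReal_mul, detReal_hyperplaneReflection hu,
    detReal_hyperplaneReflection h]
  norm_num

/-- The relation between `s` and `t` is symmetric and transitive, and it holds for `t` near `s`,
where `γ` stays away from the antipode of `γ s`; connectedness of the interval does the rest. -/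
theorem exists_isometry_timeSlice_homotopicRel {X : Type*} [TopologicalSpace X]
    (H : C(I × X, ℙ ℝ E)) (a : X) (γ : C(I, Metric.sphere (0 : E) 1))
    (hγ : ∀ t, sphereToProjective E (γ t) = H (t, a)) (s t : I) :
    ∃ A : E ≃ₗᵢ[ℝ] E, A.detReal = 1 ∧ A (γ t) = γ s ∧
      (H.timeSlice s).HomotopicRel (A.projectiveMap.comp (H.timeSlice t)) {a} := by
  have hcomp : ∀ A B : E ≃ₗᵢ[ℝ] E, ∀ f : C(X, ℙ ℝ E), A.projectiveMap.comp
      (B.projectiveMap.comp f) = (A * B).projectiveMap.comp f := fun A B f => by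
    rw [LinearIsometryEquiv.projectiveMap_mul, ContinuousMap.comp_assoc]
  refine (isPreconnected_univ (α := I)).induction₂ (fun s t => ∃ A : E ≃ₗᵢ[ℝ] E, A.detReal = 1 ∧
      A (γ t) = γ s ∧ (H.timeSlice s).HomotopicRel (A.projectiveMap.comp (H.timeSlice t)) {a})
    ?_ ?_ ?_ (Set.mem_univ s) (Set.mem_univ t)
  · intro s _
    rw [nhdsWithin_univ]
    have hne : ∀ᶠ t in 𝓝 s, dist (γ t) (γ s) < 1 :=
      γ.continuous.continuousAt.eventually (Metric.ball_mem_nhds (γ s) one_pos)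
    obtain ⟨ε, hε, hball⟩ := Metric.eventually_nhds_iff.1 hne
    refine Metric.eventually_nhds_iff.2 ⟨ε, hε, fun t ht => ?_⟩
    -- The straight segment from `s` to `t`, which stays within `ε` of `s`.
    let τ : C(I, I) := ⟨fun u => ⟨(1 - (u : ℝ)) * s + (u : ℝ) * t, by
        exact convex_Icc (𝕜 := ℝ) (0 : ℝ) 1 s.2 t.2 (sub_nonneg.2 u.2.2) u.2.1 (by ring)⟩, by fun_prop⟩
    have τ0 : τ 0 = s := Subtype.ext (by simp [τ])
    have τ1 : τ 1 = t := Subtype.ext (by simp [τ])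
    have hτ : ∀ u, dist (τ u) s < ε := fun u => by
      refine lt_of_le_of_lt ?_ ht
      rw [Subtype.dist_eq, Subtype.dist_eq, Real.dist_eq, Real.dist_eq]
      have : (τ u : ℝ) - s = (u : ℝ) * ((t : ℝ) - s) := by simp [τ]; ring
      rw [this, abs_mul, abs_of_nonneg u.2.1]
      exact mul_le_of_le_one_left (abs_nonneg _) u.2.2
    have hadd : ∀ u, (γ (τ u) : E) + γ (τ 0) ≠ 0 := fun u h => by
      have h1 := hball (hτ u)
      rw [τ0] at h
      rw [Subtype.dist_eq, dist_eq_norm, eq_neg_of_add_eq_zero_left h, ← neg_add', norm_neg,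
        ← two_smul ℝ, norm_smul] at h1
      simp at h1
    have key := timeSlice_homotopicRel_of_segment H a γ hγ τ hadd
    have hdet := detReal_sphereRotation (ne_zero_of_mem_unit_sphere (γ (τ 1))) (hadd 1)
    rw [τ0, τ1] at key hdet
    exact ⟨_, hdet, sphereRotation_apply (by simp), key⟩
  · rintro r s t - - - ⟨A, hA, hAr, hAh⟩ ⟨B, hB, hBs, hBh⟩
    refine ⟨A * B, by rw [LinearIsometryEquiv.detReal_mul, hA, hB, one_mul], ?_, ?_⟩
    · rw [LinearIsometryEquiv.mul_apply, hBs, hAr]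
    · rw [← hcomp]
      exact hAh.trans (hBh.comp_continuousMap _)
  · rintro s t - - ⟨A, hA, hAs, hAh⟩
    refine ⟨A⁻¹, ?_, ?_, ?_⟩
    · have := LinearIsometryEquiv.detReal_mul A⁻¹ A
      rwa [inv_mul_cancel, LinearIsometryEquiv.detReal_one, hA, mul_one, eq_comm] at this
    · rw [← hAs]
      exact A.symm_apply_apply _
    · have := (hAh.comp_continuousMap A⁻¹.projectiveMap).symm
      rwa [hcomp, inv_mul_cancel, LinearIsometryEquiv.projectiveMap_one,
        ContinuousMap.id_comp] at this

/-- If the ambient dimension is even, freely homotopic maps to projective space which agree at a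
point are homotopic relative to that point. -/
theorem ContinuousMap.Homotopic.homotopicRel_of_even_finrank {X : Type*} [TopologicalSpace X]
    (hE : Even (finrank ℝ E)) {f g : C(X, ℙ ℝ E)} (a : X) (h : f.Homotopic g) (ha : f a = g a) :
    f.HomotopicRel g {a} := by
  obtain ⟨F⟩ := h
  obtain ⟨v, hv⟩ := exists_sphereToProjective_eq (f a)
  let c : C(I, ℙ ℝ E) := ⟨fun t => F (t, a), by fun_prop⟩
  have hc : c 0 = sphereToProjective E v := by rw [hv]; exact F.apply_zero a
  let γ := isCoveringMap_sphereToProjective.liftPath c v hc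
  have hγ : ∀ t, sphereToProjective E (γ t) = F.toContinuousMap (t, a) := fun t =>
    congrFun (isCoveringMap_sphereToProjective.liftPath_lifts c v hc) t
  obtain ⟨A, hA, hA1, hAh⟩ := exists_isometry_timeSlice_homotopicRel F.toContinuousMap a γ hγ 0 1
  have e0 : F.toContinuousMap.timeSlice 0 = f := ContinuousMap.ext F.apply_zero
  have e1 : F.toContinuousMap.timeSlice 1 = g := ContinuousMap.ext F.apply_one
  rw [e0, e1] at hAh
  have h1 : sphereToProjective E (γ 1) = g a := (hγ 1).trans (F.apply_one a)
  have h0 : sphereToProjective E (γ 0) = g a := (hγ 0).trans ((F.apply_zero a).trans ha)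
  suffices A.projectiveMap.HomotopicRel (ContinuousMap.id _) {sphereToProjective E (γ 1)} by
    refine hAh.trans ?_
    have := this.precomp g (R := {a}) (by rintro x rfl; exact h1.symm)
    rwa [ContinuousMap.id_comp] at this
  rcases sphereToProjective_eq_iff.1 (h0.trans h1.symm) with h | h
  · exact projectiveMap_homotopicRel_id _ A (hA1.trans h) hA
  -- Here `-A` fixes `γ 1`, and it has determinant 1 because the dimension is even.
  · rw [← LinearIsometryEquiv.projectiveMap_neg]
    refine projectiveMap_homotopicRel_id _ _ ?_ ?_
    · rw [LinearIsometryEquiv.mul_apply, hA1, h]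
      exact neg_neg _
    · rw [LinearIsometryEquiv.detReal_mul, LinearIsometryEquiv.detReal_neg, hA, hE.neg_one_pow,
        one_mul]

end OddDimensional

/-! ### A signed Sperner lemma on the Kuhn triangulation of a grid. -/

section KuhnTriangulation

open Equiv Finset

variable {m : ℕ}

/-- The `k`-th vertex of the simplex with first vertex `x` in the Kuhn triangulation of the unit
grid, whose edges follow the coordinate directions `σ 0, σ 1, …`. -/
def kuhnVertex (x : Fin m → ℕ) (σ : Perm (Fin m)) (k : ℕ) : Fin m → ℕ :=
  fun i => x i + if (σ.symm i : ℕ) < k then 1 else 0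

/-- The `k`-th vertex of the simplex with first vertex `x` whose edges follow the coordinate
directions `σ 1, σ 2, …`. -/
def kuhnFaceVertex (x : Fin m → ℕ) (σ : Perm (Fin m)) (k : ℕ) : Fin m → ℕ :=
  fun i => x i + if 1 ≤ (σ.symm i : ℕ) ∧ (σ.symm i : ℕ) ≤ k then 1 else 0

/-- The cells of the grid of size `N`. -/
def gridBox (m N : ℕ) : Finset (Fin m → ℕ) :=
  Fintype.piFinset fun _ => range N

/-- The cells of the facet of the grid of size `N` on which the coordinate `i` equals `t`. -/
def gridFace (N : ℕ) (i : Fin m) (t : ℕ) : Finset (Fin m → ℕ) :=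
  Fintype.piFinset fun j => if j = i then {t} else range N

theorem mem_gridBox {N : ℕ} {x : Fin m → ℕ} : x ∈ gridBox m N ↔ ∀ j, x j < N := by
  simp [gridBox]

theorem mem_gridFace {N : ℕ} {i : Fin m} {t : ℕ} {x : Fin m → ℕ} :
    x ∈ gridFace N i t ↔ x i = t ∧ ∀ j, j ≠ i → x j < N := by
  simp only [gridFace, Fintype.mem_piFinset]
  constructor
  · intro h
    refine ⟨by simpa using h i, fun j hj => by simpa [hj] using h j⟩
  · rintro ⟨h1, h2⟩ j
    by_cases hj : j = i
    · subst hj; simpa using h1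
    · simpa [hj] using h2 j hj

/-- The sum telescopes along direction `i`: the box and its translate differ only in two opposite
facets. -/
theorem sum_gridBox_shift_sub {N : ℕ} (hN : 0 < N) (i : Fin m) (G : (Fin m → ℕ) → ℤ) :
    ∑ x ∈ gridBox m N, (G (x + Pi.single i 1) - G x) =
      ∑ x ∈ gridFace N i N, G x - ∑ x ∈ gridFace N i 0, G x := by
  have hadd : ∀ (x : Fin m → ℕ) (j : Fin m), (x + Pi.single i 1 : Fin m → ℕ) j = if j = i then x i + 1 else x j := by
    intro x j
    by_cases h : j = i
    · subst h; simp
    · simp [h]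
  have hinj : Function.Injective fun x : Fin m → ℕ => x + Pi.single i 1 := add_left_injective _
  have himg : ∀ y, y ∈ (gridBox m N).image (fun x : Fin m → ℕ => x + Pi.single i 1) ↔
      (1 ≤ y i ∧ y i ≤ N) ∧ ∀ j, j ≠ i → y j < N := by
    intro y
    simp only [mem_image, mem_gridBox]
    constructor
    · rintro ⟨x, hx, rfl⟩
      refine ⟨?_, fun j hj => by rw [hadd, if_neg hj]; exact hx j⟩
      have := hx i
      rw [hadd, if_pos rfl]
      omega
    · rintro ⟨⟨h1, h2⟩, h3⟩
      refine ⟨Function.update y i (y i - 1), fun j => ?_, ?_⟩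
      · by_cases hj : j = i
        · subst hj; rw [Function.update_self]; omega
        · rw [Function.update_of_ne hj]; exact h3 j hj
      · funext j
        rw [hadd]
        by_cases hj : j = i
        · subst hj; rw [if_pos rfl, Function.update_self]; omega
        · rw [if_neg hj, Function.update_of_ne hj]
  rw [sum_sub_distrib, ← sum_image (f := G) (fun x _ y _ h => hinj h), ← sum_sdiff_sub_sum_sdiff]
  congr 1
  · refine sum_congr ?_ fun _ _ => rfl
    ext y
    rw [mem_sdiff, himg, mem_gridBox, mem_gridFace]
    constructor
    · rintro ⟨⟨h1, h2⟩, h3⟩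
      refine ⟨?_, h2⟩
      by_contra h
      refine h3 fun j => ?_
      by_cases hj : j = i
      · subst hj; omega
      · exact h2 j hj
    · rintro ⟨h1, h2⟩
      exact ⟨⟨⟨by omega, by omega⟩, h2⟩, fun h => by have := h i; omega⟩
  · refine sum_congr ?_ fun _ _ => rfl
    ext y
    rw [mem_sdiff, himg, mem_gridBox, mem_gridFace]
    constructor
    · rintro ⟨h1, h2⟩
      refine ⟨?_, fun j _ => h1 j⟩
      by_contra h
      have := h1 i
      exact h2 ⟨⟨by omega, by omega⟩, fun j _ => h1 j⟩
    · rintro ⟨h1, h2⟩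
      refine ⟨fun j => ?_, fun h => by omega⟩
      by_cases hj : j = i
      · subst hj; omega
      · exact h2 j hj

theorem sum_sign_smul_eq_zero_of_swap {i j : Fin m} (hij : i ≠ j) (f : Perm (Fin m) → ℤ)
    (hf : ∀ σ, f (σ * swap i j) = f σ) : ∑ σ : Perm (Fin m), (Perm.sign σ : ℤ) * f σ = 0 := by
  have h := Equiv.sum_comp (Equiv.mulRight (swap i j)) fun σ => (Perm.sign σ : ℤ) * f σ
  simp only [Equiv.coe_mulRight, hf, Perm.sign_mul, Perm.sign_swap hij] at h
  simp only [mul_neg, mul_one, Units.val_neg, neg_mul, sum_neg_distrib] at h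
  linarith

variable {n : ℕ}

/-- Exchanging two consecutive steps of the path changes only the vertex between them, so the face
opposite that vertex is shared by two simplices of opposite sign. -/
theorem kuhnVertex_mul_swap (x : Fin (n + 1) → ℕ) (σ : Perm (Fin (n + 1))) (i : Fin n) {k : ℕ}
    (hk : k ≠ i + 1) :
    kuhnVertex x (σ * swap i.castSucc i.succ) k = kuhnVertex x σ k := by
  funext j
  have : (σ * swap i.castSucc i.succ).symm j = swap i.castSucc i.succ (σ.symm j) := rfl
  simp only [kuhnVertex, this]
  generalize σ.symm j = r
  have h : ((swap i.castSucc i.succ r : Fin (n + 1)) : ℕ) < k ↔ (r : ℕ) < k := by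
    rcases eq_or_ne r i.castSucc with rfl | h1
    · rw [swap_apply_left]; simp; omega
    rcases eq_or_ne r i.succ with rfl | h2
    · rw [swap_apply_right]; simp; omega
    rw [swap_apply_of_ne_of_ne h1 h2]
  simp only [h]

theorem kuhnVertex_succ (x : Fin (n + 1) → ℕ) (σ : Perm (Fin (n + 1))) (k : ℕ) :
    kuhnVertex x σ (k + 1) = kuhnFaceVertex (x + Pi.single (σ 0) 1) σ k := by
  funext i
  simp only [kuhnVertex, kuhnFaceVertex, Pi.add_apply]
  by_cases hi : i = σ 0
  · subst hi; simp
  · have : σ.symm i ≠ 0 := fun h => hi (by rw [← h, apply_symm_apply])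
    have h1 : 1 ≤ (σ.symm i : ℕ) := Nat.one_le_iff_ne_zero.2 fun h => this (Fin.ext h)
    simp [hi, h1]

theorem kuhnVertex_mul_finRotate (x : Fin (n + 1) → ℕ) (σ : Perm (Fin (n + 1))) {k : ℕ}
    (hk : k ≤ n) : kuhnVertex x (σ * finRotate (n + 1)) k = kuhnFaceVertex x σ k := by
  funext i
  have : (σ * finRotate (n + 1)).symm i = (finRotate (n + 1)).symm (σ.symm i) := rfl
  simp only [kuhnVertex, kuhnFaceVertex, this]
  obtain ⟨s, hs⟩ := (finRotate (n + 1)).surjective (σ.symm i)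
  rw [← hs, symm_apply_apply]
  have : (s : ℕ) < k ↔ 1 ≤ ((finRotate (n + 1) s : Fin (n + 1)) : ℕ) ∧
      ((finRotate (n + 1) s : Fin (n + 1)) : ℕ) ≤ k := by
    rcases eq_or_ne s (Fin.last n) with rfl | h
    · rw [finRotate_last]; simp; omega
    · rw [coe_finRotate_of_ne_last h]; omega
  simp only [this]

/-- The boundary formula for a cochain on the Kuhn triangulation of a cubical grid. -/
theorem sum_kuhn_coboundary {N : ℕ} (c : (Fin (n + 1) → Fin (n + 1) → ℕ) → ℤ) :
    ∑ σ : Perm (Fin (n + 1)), ∑ x ∈ gridBox (n + 1) N, (Perm.sign σ : ℤ) *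
        ∑ j : Fin (n + 2), (-1) ^ (j : ℕ) * c (fun k => kuhnVertex x σ (j.succAbove k)) =
      ∑ σ : Perm (Fin (n + 1)), (Perm.sign σ : ℤ) * ∑ x ∈ gridBox (n + 1) N,
        (c (fun k => kuhnFaceVertex (x + Pi.single (σ 0) 1) σ k) -
          c (fun k => kuhnFaceVertex x σ k)) := by
  simp_rw [mul_sum (s := gridBox (n + 1) N)]
  refine sum_comm.trans (Eq.trans ?_ sum_comm)
  refine sum_congr rfl fun x _ => ?_
  simp_rw [Fin.sum_univ_succ (n := n + 1), Fin.sum_univ_castSucc (n := n), mul_add, mul_sum,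
    sum_add_distrib]
  -- Faces omitting neither the first nor the last vertex cancel in pairs.
  have hmid : ∑ σ : Perm (Fin (n + 1)), ∑ i : Fin n, (Perm.sign σ : ℤ) *
      ((-1) ^ ((i.castSucc.succ : Fin (n + 2)) : ℕ) *
        c (fun k => kuhnVertex x σ (i.castSucc.succ.succAbove k))) = 0 := by
    rw [sum_comm]
    refine sum_eq_zero fun i _ => ?_
    refine sum_sign_smul_eq_zero_of_swap (i := i.castSucc) (j := i.succ)
      (by simp [Fin.ext_iff]) _ fun σ => ?_
    congr 2
    funext k
    refine kuhnVertex_mul_swap x σ i fun h => ?_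
    exact Fin.succAbove_ne i.castSucc.succ k (Fin.ext (by simpa using h))
  have hlast : ∑ σ : Perm (Fin (n + 1)), (Perm.sign σ : ℤ) *
      ((-1) ^ (((Fin.last n).succ : Fin (n + 2)) : ℕ) *
        c (fun k => kuhnVertex x σ ((Fin.last n).succ.succAbove k))) =
      - ∑ σ : Perm (Fin (n + 1)), (Perm.sign σ : ℤ) * c (fun k => kuhnFaceVertex x σ k) := by
    -- Rotating the order of the directions makes `σ 0` the last step, which the omitted last vertex
    -- removes; the sign of the rotation and that of the face multiply to -1.
    rw [← Equiv.sum_comp (Equiv.mulRight (finRotate (n + 1))), ← sum_neg_distrib]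
    refine sum_congr rfl fun σ _ => ?_
    have h1 : (fun k : Fin (n + 1) => kuhnVertex x (Equiv.mulRight (finRotate (n + 1)) σ)
        ((Fin.last n).succ.succAbove k)) = fun k : Fin (n + 1) => kuhnFaceVertex x σ k := by
      funext k
      rw [Equiv.coe_mulRight, ← kuhnVertex_mul_finRotate x σ (Nat.lt_succ_iff.1 k.2),
        Fin.succ_last, Fin.succAbove_last]
      rfl
    rw [h1, Equiv.coe_mulRight, Perm.sign_mul, sign_finRotate]
    have h2 : ((-1 : ℤ) ^ n) * (-1) ^ (n + 1) = -1 := by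
      rw [pow_succ, ← mul_assoc, ← pow_add, ← two_mul, pow_mul]; norm_num
    simp only [Fin.succ_last, Fin.val_last, Units.val_mul, Units.val_pow_eq_pow_val, Units.val_neg,
      Units.val_one, Nat.add_sub_cancel, Nat.succ_eq_add_one]
    linear_combination (Perm.sign σ : ℤ) * c (fun k => kuhnFaceVertex x σ k) * h2
  rw [hmid, hlast, zero_add, ← sub_eq_add_neg, ← sum_sub_distrib]
  refine sum_congr rfl fun σ _ => ?_
  simp only [Fin.val_zero, pow_zero, one_mul, Fin.succAbove_zero, Fin.val_succ, kuhnVertex_succ]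
  ring

/-- The value of a cochain on the Kuhn triangulation of the facet `{x | x 0 = t}` of the grid. -/
def kuhnFaceSum (c : (Fin (n + 1) → Fin (n + 1) → ℕ) → ℤ) (N t : ℕ) : ℤ :=
  ∑ σ : Perm (Fin (n + 1)) with σ 0 = 0, (Perm.sign σ : ℤ) *
    ∑ x ∈ gridFace N 0 t, c (fun k => kuhnFaceVertex x σ k)

/-- Discrete Stokes: the cochain is closed and vanishes on the side facets, so only the two facets
orthogonal to the direction 0 contribute. -/
theorem kuhnFaceSum_eq {N : ℕ} (hN : 0 < N) (c : (Fin (n + 1) → Fin (n + 1) → ℕ) → ℤ)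
    (hc : ∀ x ∈ gridBox (n + 1) N, ∀ σ : Perm (Fin (n + 1)),
      ∑ j : Fin (n + 2), (-1) ^ (j : ℕ) * c (fun k => kuhnVertex x σ (j.succAbove k)) = 0)
    (hside : ∀ σ : Perm (Fin (n + 1)), σ 0 ≠ 0 → ∀ t, t = 0 ∨ t = N → ∀ x ∈ gridFace N (σ 0) t,
      c (fun k => kuhnFaceVertex x σ k) = 0) :
    kuhnFaceSum c N N = kuhnFaceSum c N 0 := by
  have h := sum_kuhn_coboundary (N := N) c
  rw [sum_eq_zero fun σ _ => sum_eq_zero fun x hx => by rw [hc x hx, mul_zero]] at h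
  have hshift : ∀ σ : Perm (Fin (n + 1)), ∑ x ∈ gridBox (n + 1) N,
      (c (fun k => kuhnFaceVertex (x + Pi.single (σ 0) 1) σ k) -
        c (fun k => kuhnFaceVertex x σ k)) =
      ∑ x ∈ gridFace N (σ 0) N, c (fun k => kuhnFaceVertex x σ k) -
        ∑ x ∈ gridFace N (σ 0) 0, c (fun k => kuhnFaceVertex x σ k) := fun σ =>
    sum_gridBox_shift_sub hN (σ 0) fun x => c (fun k => kuhnFaceVertex x σ k)
  simp_rw [hshift] at h
  rw [← sub_eq_zero, kuhnFaceSum, kuhnFaceSum, ← sum_sub_distrib, h, sum_filter]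
  refine sum_congr rfl fun σ _ => ?_
  split_ifs with h0
  · rw [h0, mul_sub]
  · rw [sum_eq_zero (hside σ h0 N (Or.inr rfl)), sum_eq_zero (hside σ h0 0 (Or.inl rfl)), sub_zero,
      mul_zero]

/-- The vector attached to a label: a basis vector, or zero for the exceptional label. -/
def labelVector (o : Option (Fin (n + 1))) : Fin (n + 1) → ℤ :=
  o.elim 0 fun i => Pi.single i 1

/-- The cochain on simplices with labelled vertices which counts, with signs, the simplices whose
vertices carry all labels but the exceptional one. -/
def labelCochain (L : (Fin (n + 1) → ℕ) → Option (Fin (n + 1)))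
    (v : Fin (n + 1) → Fin (n + 1) → ℕ) : ℤ :=
  Matrix.det (Matrix.of fun k => labelVector (L (v k)))

theorem sum_det_labelVector_succAbove_eq_zero (l : Fin (n + 2) → Option (Fin (n + 1)))
    (hl : ¬ Function.Surjective l) :
    ∑ j : Fin (n + 2), (-1) ^ (j : ℕ) *
      Matrix.det (Matrix.of fun k => labelVector (l (j.succAbove k))) = 0 := by
  by_cases hsome : ∃ i, ∀ j, l j ≠ some i
  · obtain ⟨i, hi⟩ := hsome
    refine sum_eq_zero fun j _ => ?_
    rw [Matrix.det_eq_zero_of_column_eq_zero i, mul_zero]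
    intro k
    have := hi (j.succAbove k)
    rw [Matrix.of_apply]
    cases h : l (j.succAbove k) with
    | none => rfl
    | some i' =>
      have : i ≠ i' := fun e => this (by rw [h, e])
      simp [labelVector, this]
  · push Not at hsome
    have hnone : ∀ j, l j ≠ none := fun j hj => hl fun o => by
      cases o with
      | none => exact ⟨j, hj⟩
      | some i => exact hsome i
    -- With the exceptional label absent, the alternating sum is the expansion along a prepended
    -- column of ones. Each label vector has coordinate sum 1, so (-1, 1, …, 1) lies in the kernel.
    let M : Matrix (Fin (n + 2)) (Fin (n + 2)) ℤ :=
      Matrix.of fun j => Fin.cons 1 (labelVector (l j))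
    have hM : M.det = 0 := by
      refine Matrix.exists_mulVec_eq_zero_iff.1 ⟨Fin.cons (-1) fun _ => 1, fun h => ?_, ?_⟩
      · simpa using congrFun h 0
      · funext j
        obtain ⟨i, hi⟩ := Option.ne_none_iff_exists'.1 (hnone j)
        simp [Matrix.mulVec, dotProduct, Fin.sum_univ_succ (n := n + 1), M, hi, labelVector]
    rw [Matrix.det_succ_column_zero] at hM
    rw [← hM]
    refine sum_congr rfl fun j _ => ?_
    simp only [M, Matrix.of_apply, Fin.cons_zero, mul_one]
    rfl

theorem kuhnFaceVertex_le {N t : ℕ} {σ : Perm (Fin (n + 1))} {x : Fin (n + 1) → ℕ}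
    (hx : x ∈ gridFace N (σ 0) t) (ht : t ≤ N) (k : ℕ) (i : Fin (n + 1)) :
    kuhnFaceVertex x σ k i ≤ N := by
  rw [mem_gridFace] at hx
  by_cases hi : i = σ 0
  · subst hi; simp [kuhnFaceVertex, hx.1, ht]
  · have := hx.2 i hi
    unfold kuhnFaceVertex
    split_ifs <;> omega

theorem kuhnFaceVertex_apply_zero (x : Fin (n + 1) → ℕ) (σ : Perm (Fin (n + 1))) (k : ℕ) :
    kuhnFaceVertex x σ k (σ 0) = x (σ 0) := by
  simp [kuhnFaceVertex]

theorem labelCochain_kuhnFaceSum_eq {N : ℕ} (hN : 0 < N)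
    (L : (Fin (n + 1) → ℕ) → Option (Fin (n + 1)))
    (hL : ∀ x ∈ gridBox (n + 1) N, ∀ σ : Perm (Fin (n + 1)),
      ¬ Function.Surjective fun j : Fin (n + 2) => L (kuhnVertex x σ j))
    (hside : ∀ y : Fin (n + 1) → ℕ, (∀ i, y i ≤ N) → ∀ i, i ≠ 0 → (y i = 0 ∨ y i = N) →
      L y = none) :
    kuhnFaceSum (labelCochain L) N N = kuhnFaceSum (labelCochain L) N 0 := by
  refine kuhnFaceSum_eq hN _ (fun x hx σ => ?_) fun σ hσ t ht x hx => ?_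
  · exact sum_det_labelVector_succAbove_eq_zero _ (hL x hx σ)
  · refine Matrix.det_eq_zero_of_row_eq_zero 0 fun j => ?_
    rw [Matrix.of_apply, hside _ (fun i => kuhnFaceVertex_le hx (by omega) _ i) (σ 0) hσ]
    · rfl
    · rw [kuhnFaceVertex_apply_zero, (mem_gridFace.1 hx).1]
      exact ht

/-- Permuting coordinates preserves the Kuhn triangulation, and a transposition reverses the sign of
every simplex. This symmetry is why the reflection is put in the form of a coordinate swap. -/
theorem kuhnFaceSum_eq_neg_of_swap {N : ℕ} (L : (Fin (n + 1) → ℕ) → Option (Fin (n + 1)))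
    {a b : Fin (n + 1)} (ha : a ≠ 0) (hb : b ≠ 0) (hab : a ≠ b)
    (hL : ∀ y : Fin (n + 1) → ℕ, (∀ i, y i ≤ N) → y 0 = N →
      L y = L fun i => if i = 0 then 0 else y (swap a b i)) :
    kuhnFaceSum (labelCochain L) N N = - kuhnFaceSum (labelCochain L) N 0 := by
  have hs0 : swap a b 0 = 0 := swap_apply_of_ne_of_ne ha.symm hb.symm
  have hs : ∀ i, swap a b i = 0 ↔ i = 0 := fun i => by
    rw [← hs0, (swap a b).apply_eq_iff_eq, hs0]
  rw [kuhnFaceSum, kuhnFaceSum, ← sum_neg_distrib]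
  refine sum_equiv (Equiv.mulLeft (swap a b)) (fun σ => ?_) fun σ hσ => ?_
  · simp [hs]
  have hσ0 : σ 0 = 0 := by simpa using hσ
  rw [Equiv.coe_mulLeft, Perm.sign_mul, Perm.sign_swap hab, Units.val_mul, Units.val_neg,
    Units.val_one, neg_one_mul, neg_mul, neg_neg]
  congr 1
  refine sum_nbij' (fun x i => if i = 0 then 0 else x (swap a b i))
    (fun x i => if i = 0 then N else x (swap a b i)) ?_ ?_ ?_ ?_ ?_
  · intro x hx
    rw [mem_gridFace] at hx ⊢
    exact ⟨by simp, fun j hj => by simpa [hj] using hx.2 _ fun h => hj ((hs j).1 h)⟩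
  · intro x hx
    rw [mem_gridFace] at hx ⊢
    exact ⟨by simp, fun j hj => by simpa [hj] using hx.2 _ fun h => hj ((hs j).1 h)⟩
  · intro x hx
    rw [mem_gridFace] at hx
    funext i
    by_cases hi : i = 0
    · simp [hi, hx.1]
    · simp [hi, hs]
  · intro x hx
    rw [mem_gridFace] at hx
    funext i
    by_cases hi : i = 0
    · simp [hi, hx.1]
    · simp [hi, hs]
  · intro x hx
    unfold labelCochain
    congr 2
    funext k
    have hx' := mem_gridFace.1 hx
    rw [hL _ (fun i => kuhnFaceVertex_le (σ := σ) (by rwa [hσ0]) le_rfl _ i)]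
    · congr 2
      funext i
      have h1 : (swap a b * σ).symm i = σ.symm (swap a b i) := rfl
      simp only [kuhnFaceVertex, h1]
      by_cases hi : i = 0
      · have : σ.symm 0 = 0 := by rw [symm_apply_eq, hσ0]
        simp [hi, hs0, this]
      · simp [hi]
    · have := kuhnFaceVertex_apply_zero x σ k
      rwa [hσ0, hx'.1] at this

theorem Fin.strictMono_self_eq_id {N : ℕ} {f : Fin N → Fin N} (hf : StrictMono f) (k : Fin N) :
    f k = k := by
  have := Subsingleton.elim
    (StrictMono.orderIsoOfSurjective f hf (Finite.surjective_of_injective hf.injective))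
    (OrderIso.refl _)
  exact congrArg (fun e : Fin N ≃o Fin N => e k) this

/-- A simplex with nonzero count has distinct non-exceptional labels, increasing along the simplex,
so vertex `k` has label `k`. This forces each coordinate to pass `M` at its own step, leaving only
the simplex at the centre with directions in order. -/
theorem kuhnFaceSum_eq_one {N M : ℕ} (hM : M < N) (L : (Fin (n + 1) → ℕ) → Option (Fin (n + 1)))
    (hL : ∀ y : Fin (n + 1) → ℕ, (∀ i, y i ≤ N) → y 0 = 0 → ∀ j, L y = some j →
      (∀ i : Fin n, (i : ℕ) < j → M < y i.succ) ∧ ∀ i : Fin n, (i : ℕ) = j → y i.succ ≤ M)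
    (hcenter : ∀ k : Fin (n + 1),
      L (fun i => if i = 0 then 0 else M + if i ≤ k then 1 else 0) = some k) :
    kuhnFaceSum (labelCochain L) N 0 = 1 := by
  have key : ∀ σ : Perm (Fin (n + 1)), σ 0 = 0 → ∀ x ∈ gridFace N (0 : Fin (n + 1)) 0,
      labelCochain L (fun k => kuhnFaceVertex x σ k) ≠ 0 →
        σ = 1 ∧ x = fun i => if i = 0 then 0 else M := by
    intro σ hσ x hx hdet
    have hx' := mem_gridFace.1 hx
    have hv0 : ∀ k : ℕ, kuhnFaceVertex x σ k 0 = 0 := fun k => by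
      have := kuhnFaceVertex_apply_zero x σ k
      rwa [hσ, hx'.1] at this
    have hle : ∀ (k : ℕ) (i : Fin (n + 1)), kuhnFaceVertex x σ k i ≤ N :=
      kuhnFaceVertex_le (σ := σ) (by rwa [hσ]) (Nat.zero_le N)
    have hsome : ∀ k : Fin (n + 1), ∃ j, L (kuhnFaceVertex x σ k) = some j := fun k => by
      by_contra h
      push Not at h
      refine hdet (Matrix.det_eq_zero_of_row_eq_zero k fun j => ?_)
      rw [Matrix.of_apply, Option.eq_none_iff_forall_ne_some.2 h]
      rfl
    choose π hπ using hsome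
    have hinj : Function.Injective π := fun k k' h => by
      by_contra hne
      exact hdet (Matrix.det_zero_of_row_eq hne
        (congrArg labelVector ((hπ k).trans ((congrArg some h).trans (hπ k').symm))))
    -- Coordinates do not decrease along the simplex, so one exceeding `M` at vertex `k` cannot be
    -- at most `M` at a later vertex `k'`.
    have hmono : Monotone π := fun k k' hk => by
      by_contra h
      push Not at h
      have hlt : (π k' : ℕ) < n := lt_of_lt_of_le h (Nat.lt_succ_iff.1 (π k).2)
      have h1 := (hL _ (hle _) (hv0 k) _ (hπ k)).1 ⟨π k', hlt⟩ h
      have h2 := (hL _ (hle _) (hv0 k') _ (hπ k')).2 ⟨π k', hlt⟩ rfl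
      have hk : (k : ℕ) ≤ k' := hk
      unfold kuhnFaceVertex at h1 h2
      split_ifs at h1 h2 <;> omega
    have hid := Fin.strictMono_self_eq_id (hmono.strictMono_of_injective hinj)
    have hi : ∀ i : Fin n, σ.symm i.succ = i.succ ∧ x i.succ = M := fun i => by
      have h1 := (hL _ (hle _) (hv0 i.succ) _ (hπ i.succ)).1 i (by rw [hid]; simp)
      have h2 := (hL _ (hle _) (hv0 i.castSucc) _ (hπ i.castSucc)).2 i (by rw [hid]; simp)
      unfold kuhnFaceVertex at h1 h2
      rw [Fin.ext_iff]
      simp only [Fin.val_succ, Fin.val_castSucc] at h1 h2 ⊢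
      split_ifs at h1 h2 <;> omega
    constructor
    · ext i
      congr 1
      refine Fin.cases hσ (fun i => ?_) i
      exact ((symm_apply_eq σ).1 (hi i).1).symm
    · funext i
      refine Fin.cases (by simpa using hx'.1) (fun i => ?_) i
      simpa [Fin.succ_ne_zero] using (hi i).2
  have hmem : (fun i : Fin (n + 1) => if i = 0 then 0 else M) ∈ gridFace N (0 : Fin (n + 1)) 0 :=
    mem_gridFace.2 ⟨by simp, fun j hj => by simpa [hj] using hM⟩
  rw [kuhnFaceSum, sum_eq_single 1, sum_eq_single (fun i => if i = 0 then 0 else M)]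
  · rw [Perm.sign_one, Units.val_one, one_mul, labelCochain, ← Matrix.det_one (n := Fin (n + 1))]
    congr 1
    ext k j
    have : kuhnFaceVertex (fun i : Fin (n + 1) => if i = 0 then 0 else M) 1 k =
        fun i => if i = 0 then 0 else M + if i ≤ k then 1 else 0 := by
      funext i
      have h1 : (1 : Perm (Fin (n + 1))).symm i = i := rfl
      simp only [kuhnFaceVertex, h1]
      by_cases hi : i = 0
      · simp [hi]
      · have : 1 ≤ (i : ℕ) := Nat.one_le_iff_ne_zero.2 fun h => hi (Fin.ext h)
        simp only [hi, this, Fin.le_def, true_and, if_false]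
    change labelVector (L (kuhnFaceVertex (fun i => if i = 0 then 0 else M) 1 k)) j = _
    rw [this, hcenter, Matrix.one_apply]
    simp [labelVector, Pi.single_apply, eq_comm]
  · intro x hx hne
    by_contra h
    exact hne (key 1 rfl x hx h).2
  · exact fun h => (h hmem).elim
  · intro σ hσ hne
    rw [sum_eq_zero, mul_zero]
    intro x hx
    by_contra h
    exact hne (key σ (by simpa using hσ) x hx h).1
  · intro h
    simp at h

/-- A labelling of a grid which is homotopic to its composition with a coordinate swap, and which
has exactly one fully labelled simplex on the initial facet, has a simplex with all labels. -/
theorem exists_surjective_label {N M : ℕ} (hM : M < N)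
    (L : (Fin (n + 1) → ℕ) → Option (Fin (n + 1)))
    (hside : ∀ y : Fin (n + 1) → ℕ, (∀ i, y i ≤ N) → ∀ i, i ≠ 0 → (y i = 0 ∨ y i = N) →
      L y = none)
    {a b : Fin (n + 1)} (ha : a ≠ 0) (hb : b ≠ 0) (hab : a ≠ b)
    (hswap : ∀ y : Fin (n + 1) → ℕ, (∀ i, y i ≤ N) → y 0 = N →
      L y = L fun i => if i = 0 then 0 else y (swap a b i))
    (hL : ∀ y : Fin (n + 1) → ℕ, (∀ i, y i ≤ N) → y 0 = 0 → ∀ j, L y = some j →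
      (∀ i : Fin n, (i : ℕ) < j → M < y i.succ) ∧ ∀ i : Fin n, (i : ℕ) = j → y i.succ ≤ M)
    (hcenter : ∀ k : Fin (n + 1),
      L (fun i => if i = 0 then 0 else M + if i ≤ k then 1 else 0) = some k) :
    ∃ x ∈ gridBox (n + 1) N, ∃ σ : Perm (Fin (n + 1)),
      Function.Surjective fun j : Fin (n + 2) => L (kuhnVertex x σ j) := by
  by_contra h
  push Not at h
  have h1 := labelCochain_kuhnFaceSum_eq (by omega) L h hside
  rw [kuhnFaceSum_eq_neg_of_swap L ha hb hab hswap, kuhnFaceSum_eq_one hM L hL hcenter] at h1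
  norm_num at h1

end KuhnTriangulation

/-! ### Labelling the sphere, and the closed regions of the labels. -/

section SphereLabel

open Finset

variable {n : ℕ}

/-- The label `j` of a point away from the pole is the index of its first non-positive coordinate
after the zeroth one, or `n` if there is none. -/
def IsSphereLabel (y : Fin (n + 1) → ℝ) (j : Fin (n + 1)) : Prop :=
  (∀ i : Fin n, (i : ℕ) < j → 0 < y i.succ) ∧ ∀ i : Fin n, (i : ℕ) = j → y i.succ ≤ 0

theorem exists_isSphereLabel (y : Fin (n + 1) → ℝ) : ∃ j, IsSphereLabel y j := by
  classical
  by_cases h : ∃ j : ℕ, ∃ hj : j < n, y (⟨j, hj⟩ : Fin n).succ ≤ 0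
  · obtain ⟨hlt, hle⟩ := Nat.find_spec h
    refine ⟨⟨Nat.find h, hlt.trans (Nat.lt_succ_self n)⟩, fun i hi => ?_, fun i hi => ?_⟩
    · by_contra hc
      exact Nat.find_min h hi ⟨i.2, not_lt.1 hc⟩
    · have : i = ⟨Nat.find h, hlt⟩ := Fin.ext hi
      rwa [this]
  · push Not at h
    exact ⟨Fin.last n, fun i _ => h i i.2, fun i hi => absurd hi i.2.ne⟩

theorem IsSphereLabel.unique {y : Fin (n + 1) → ℝ} {j k : Fin (n + 1)} (hj : IsSphereLabel y j)
    (hk : IsSphereLabel y k) : j = k := by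
  by_contra hne
  wlog h : j < k generalizing j k
  · exact this hk hj (Ne.symm hne) (lt_of_le_of_ne (not_lt.1 h) (Ne.symm hne))
  have hlt : (j : ℕ) < n := lt_of_lt_of_le h (Nat.lt_succ_iff.1 k.2)
  exact (hk.1 ⟨j, hlt⟩ h).not_ge (hj.2 ⟨j, hlt⟩ rfl)

open Classical in
/-- A labelling of the sphere by `n + 2` labels, the exceptional label marking a neighbourhood of
the pole. -/
noncomputable def sphereLabel (y : Fin (n + 1) → ℝ) : Option (Fin (n + 1)) :=
  if 1 / 2 < y 0 then none else some (exists_isSphereLabel y).choose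

theorem sphereLabel_eq_none {y : Fin (n + 1) → ℝ} (h : 1 / 2 < y 0) : sphereLabel y = none :=
  if_pos h

theorem sphereLabel_eq_some_iff {y : Fin (n + 1) → ℝ} {j : Fin (n + 1)} :
    sphereLabel y = some j ↔ y 0 ≤ 1 / 2 ∧ IsSphereLabel y j := by
  unfold sphereLabel
  split_ifs with h
  · exact iff_of_false not_false fun e => h.not_ge e.1
  · have hs := (exists_isSphereLabel y).choose_spec
    rw [Option.some_inj]
    exact ⟨fun e => ⟨not_lt.1 h, e ▸ hs⟩, fun e => hs.unique e.2⟩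

/-- A closed set containing all points with a given label. -/
def labelRegion : Option (Fin (n + 1)) → Set (Fin (n + 1) → ℝ)
  | none => {y | 1 / 2 ≤ y 0}
  | some j => {y | y 0 ≤ 1 / 2 ∧ ∀ i : Fin n,
      ((i : ℕ) < j → 0 ≤ y i.succ) ∧ ((i : ℕ) = j → y i.succ ≤ 0)}

theorem isClosed_labelRegion (o : Option (Fin (n + 1))) : IsClosed (labelRegion o) := by
  cases o with
  | none => exact isClosed_le continuous_const (continuous_apply 0)
  | some j =>
    have : labelRegion (some j) = {y : Fin (n + 1) → ℝ | y 0 ≤ 1 / 2} ∩ ⋂ i : Fin n,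
        ({y | (i : ℕ) < j → 0 ≤ y i.succ} ∩ {y | (i : ℕ) = j → y i.succ ≤ 0}) := by
      ext y
      simp [labelRegion]
    rw [this]
    refine (isClosed_le (continuous_apply 0) continuous_const).inter
      (isClosed_iInter fun i => IsClosed.inter ?_ ?_)
    · exact isClosed_imp isOpen_const (isClosed_le continuous_const (continuous_apply _))
    · exact isClosed_imp isOpen_const (isClosed_le (continuous_apply _) continuous_const)

theorem mem_labelRegion_sphereLabel (y : Fin (n + 1) → ℝ) : y ∈ labelRegion (sphereLabel y) := by
  cases h : sphereLabel y with
  | none =>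
    by_contra hc
    have h1 : y 0 ≤ 1 / 2 := (not_le.1 hc).le
    obtain ⟨j, hj⟩ := exists_isSphereLabel y
    rw [sphereLabel_eq_some_iff.2 ⟨h1, hj⟩] at h
    exact Option.some_ne_none _ h
  | some j =>
    obtain ⟨h0, h1, h2⟩ := sphereLabel_eq_some_iff.1 h
    exact ⟨h0, fun i => ⟨fun hi => (h1 i hi).le, h2 i⟩⟩

/-- The only point in all the regions would be (1/2, 0, …, 0), which is not on the unit sphere. -/
theorem exists_notMem_labelRegion {y : Fin (n + 1) → ℝ} (hy : ∑ i, y i ^ 2 = 1) :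
    ∃ o, y ∉ labelRegion o := by
  by_contra! h
  have h0 : y 0 = 1 / 2 := le_antisymm (h (some 0)).1 (h none)
  have hs : ∀ i : Fin n, y i.succ = 0 := fun i =>
    le_antisymm (((h (some i.castSucc)).2 i).2 rfl) (((h (some (Fin.last n))).2 i).1 i.2)
  rw [Fin.sum_univ_succ] at hy
  simp [h0, hs] at hy
  norm_num at hy

end SphereLabel

/-! ### Collapsing the walls of a cube to the pole of the sphere. -/

section Collapse

open Finset

variable {n : ℕ}

/-- A product vanishing exactly on the walls of the cube. -/
def cubeBump (z : Fin n → ℝ) : ℝ :=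
  ∏ i, (1 - z i ^ 2)

/-- The two terms do not vanish together, because the bump equals 1 at the origin; hence the
collapse is defined on the walls too. -/
theorem collapse_denom_pos (z : Fin n → ℝ) : 0 < ∑ i, z i ^ 2 + cubeBump z ^ 2 := by
  have h1 : 0 ≤ ∑ i, z i ^ 2 := sum_nonneg fun i _ => sq_nonneg _
  by_cases h : ∑ i, z i ^ 2 = 0
  · have hz : ∀ i, z i ^ 2 = 0 := fun i =>
      (sum_eq_zero_iff_of_nonneg fun i _ => sq_nonneg _).1 h i (mem_univ i)
    rw [h, cubeBump]
    simp [hz]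
  · have := lt_of_le_of_ne h1 (Ne.symm h)
    positivity

/-- The coordinates of a map from the cube to the sphere which collapses the walls to the pole:
inverse stereographic projection composed with a rescaling of the open cube. -/
noncomputable def collapseCoord (z : Fin n → ℝ) : Fin (n + 1) → ℝ :=
  Fin.cons ((∑ i, z i ^ 2 - cubeBump z ^ 2) / (∑ i, z i ^ 2 + cubeBump z ^ 2))
    fun i => 2 * cubeBump z * z i / (∑ i, z i ^ 2 + cubeBump z ^ 2)

theorem collapseCoord_zero (z : Fin n → ℝ) : collapseCoord z 0 =
    (∑ i, z i ^ 2 - cubeBump z ^ 2) / (∑ i, z i ^ 2 + cubeBump z ^ 2) :=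
  rfl

theorem collapseCoord_succ (z : Fin n → ℝ) (i : Fin n) : collapseCoord z i.succ =
    2 * cubeBump z * z i / (∑ i, z i ^ 2 + cubeBump z ^ 2) :=
  rfl

theorem sum_collapseCoord_sq (z : Fin n → ℝ) : ∑ i, collapseCoord z i ^ 2 = 1 := by
  have h := (collapse_denom_pos z).ne'
  rw [Fin.sum_univ_succ]
  simp_rw [collapseCoord_succ, collapseCoord_zero, div_pow, mul_pow]
  rw [← sum_div, ← mul_sum, ← add_div, div_eq_one_iff_eq (pow_ne_zero 2 h)]
  ring

theorem continuous_collapseCoord : Continuous (collapseCoord (n := n)) := by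
  have h1 : Continuous fun z : Fin n → ℝ => ∑ i, z i ^ 2 := by fun_prop
  have h2 : Continuous fun z : Fin n → ℝ => cubeBump z := by unfold cubeBump; fun_prop
  refine continuous_pi fun i => Fin.cases ?_ (fun i => ?_) i
  · simp_rw [collapseCoord_zero]
    exact (h1.sub (h2.pow 2)).div (h1.add (h2.pow 2)) fun z => (collapse_denom_pos z).ne'
  · simp_rw [collapseCoord_succ]
    exact ((continuous_const.mul h2).mul (continuous_apply i)).div (h1.add (h2.pow 2))
      fun z => (collapse_denom_pos z).ne'

/-- A map from the cube to the sphere which collapses the walls to the pole. -/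
noncomputable def collapse (z : Fin n → ℝ) :
    Metric.sphere (0 : EuclideanSpace ℝ (Fin (n + 1))) 1 :=
  ⟨WithLp.toLp 2 (collapseCoord z), by
    rw [mem_sphere_zero_iff_norm, EuclideanSpace.norm_eq]
    simp [sum_collapseCoord_sq]⟩

theorem collapse_apply (z : Fin n → ℝ) (i : Fin (n + 1)) :
    (collapse z : EuclideanSpace ℝ (Fin (n + 1))) i = collapseCoord z i :=
  rfl

theorem continuous_collapse : Continuous (collapse (n := n)) :=
  ((PiLp.continuous_toLp 2 _).comp continuous_collapseCoord).subtype_mk _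

theorem collapseCoord_eq_of_wall {z : Fin n → ℝ} {i : Fin n} (h : z i ^ 2 = 1) :
    collapseCoord z = Pi.single 0 1 := by
  have hb : cubeBump z = 0 := prod_eq_zero (mem_univ i) (by rw [h, sub_self])
  have hd := (collapse_denom_pos z).ne'
  rw [hb] at hd
  funext j
  refine Fin.cases ?_ (fun j => ?_) j
  · rw [collapseCoord_zero, hb, Pi.single_eq_same]
    simp only [ne_eq, OfNat.ofNat_ne_zero, not_false_eq_true, zero_pow, sub_zero, add_zero] at hd ⊢
    exact div_self hd
  · rw [collapseCoord_succ, hb, Pi.single_eq_of_ne (Fin.succ_ne_zero j)]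
    simp

theorem cubeBump_nonneg {z : Fin n → ℝ} (h : ∀ i, z i ^ 2 ≤ 1) : 0 ≤ cubeBump z :=
  prod_nonneg fun i _ => sub_nonneg.2 (h i)

theorem collapseCoord_succ_pos {z : Fin n → ℝ} (h : 0 < cubeBump z) {i : Fin n} :
    0 < collapseCoord z i.succ ↔ 0 < z i := by
  rw [collapseCoord_succ, div_pos_iff_of_pos_right (collapse_denom_pos z)]
  exact mul_pos_iff_of_pos_left (by positivity)

theorem collapseCoord_comp_perm (z : Fin n → ℝ) (a b : Fin n) :
    collapseCoord (z ∘ Equiv.swap a b) = collapseCoord z ∘ Equiv.swap a.succ b.succ := by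
  have h1 : ∑ i, (z ∘ Equiv.swap a b) i ^ 2 = ∑ i, z i ^ 2 :=
    Equiv.sum_comp (Equiv.swap a b) fun i => z i ^ 2
  have h2 : cubeBump (z ∘ Equiv.swap a b) = cubeBump z :=
    Equiv.prod_comp (Equiv.swap a b) fun i => 1 - z i ^ 2
  funext i
  refine Fin.cases ?_ (fun i => ?_) i
  · rw [Function.comp_apply, Equiv.swap_apply_of_ne_of_ne (Fin.succ_ne_zero a).symm
      (Fin.succ_ne_zero b).symm, collapseCoord_zero, collapseCoord_zero, h1, h2]
  · rw [Function.comp_apply, ← (Fin.succ_injective n).map_swap, collapseCoord_succ,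
      collapseCoord_succ, h1, h2, Function.comp_apply]

end Collapse

/-! ### A coordinate swap of the sphere is not homotopic to the identity relative to the pole. -/

section SwapNotHomotopic

open scoped unitInterval

variable {n : ℕ}

/-- The position of a grid point in the product of the unit interval with a cube. -/
noncomputable def gridPoint (M : ℕ) (y : Fin (n + 1) → ℕ) : Fin (n + 1) → ℝ :=
  Fin.cons ((y 0 : ℝ) / (2 * M : ℕ)) fun i => (y i.succ : ℝ) / M - 1

theorem gridPoint_mem_Icc {M : ℕ} {y : Fin (n + 1) → ℕ} (hM : 0 < M) (hy : ∀ i, y i ≤ 2 * M) :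
    gridPoint M y ∈ Set.Icc (-1 : Fin (n + 1) → ℝ) 1 := by
  have hM' : (0 : ℝ) < M := by exact_mod_cast hM
  have hy' : ∀ i, (y i : ℝ) ≤ 2 * M := fun i => by exact_mod_cast hy i
  have h0 : ∀ i, (0 : ℝ) ≤ y i := fun i => Nat.cast_nonneg _
  constructor
  · intro i
    refine Fin.cases ?_ (fun i => ?_) i
    · change (-1 : ℝ) ≤ (y 0 : ℝ) / (2 * M : ℕ)
      have : (0 : ℝ) ≤ (y 0 : ℝ) / (2 * M : ℕ) := by positivity
      linarith
    · change (-1 : ℝ) ≤ (y i.succ : ℝ) / M - 1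
      have : (0 : ℝ) ≤ (y i.succ : ℝ) / M := by positivity
      linarith
  · intro i
    refine Fin.cases ?_ (fun i => ?_) i
    · change (y 0 : ℝ) / (2 * M : ℕ) ≤ 1
      rw [div_le_one (by push_cast; positivity)]
      push_cast
      exact hy' 0
    · change (y i.succ : ℝ) / M - 1 ≤ 1
      have : (y i.succ : ℝ) / M ≤ 2 := by
        rw [div_le_iff₀ hM']
        exact hy' _
      linarith

theorem dist_gridPoint_kuhnVertex_le {M : ℕ} (hM : 0 < M) (x : Fin (n + 1) → ℕ)
    (τ : Equiv.Perm (Fin (n + 1))) (k : ℕ) :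
    dist (gridPoint M (kuhnVertex x τ k)) (gridPoint M x) ≤ 1 / M := by
  have hM' : (0 : ℝ) < M := by exact_mod_cast hM
  have hk : ∀ i, |(kuhnVertex x τ k i : ℝ) - x i| ≤ 1 := fun i => by
    unfold kuhnVertex
    split_ifs <;> simp
  refine (dist_pi_le_iff (by positivity)).2 fun i => Fin.cases ?_ (fun i => ?_) i
  · change |(kuhnVertex x τ k 0 : ℝ) / (2 * M : ℕ) - (x 0 : ℝ) / (2 * M : ℕ)| ≤ 1 / M
    rw [← sub_div, abs_div, abs_of_nonneg (Nat.cast_nonneg (2 * M) : (0 : ℝ) ≤ (2 * M : ℕ))]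
    refine div_le_div₀ zero_le_one (hk 0) hM' ?_
    push_cast
    linarith
  · change |((kuhnVertex x τ k i.succ : ℝ) / M - 1) - ((x i.succ : ℝ) / M - 1)| ≤ 1 / M
    rw [sub_sub_sub_cancel_right, ← sub_div, abs_div, abs_of_pos hM']
    exact div_le_div_of_nonneg_right (hk _) hM'.le

/-- There is no homotopy of self-maps of the sphere fixing a pole from the identity to the map
exchanging two coordinates other than that of the pole. -/
theorem not_homotopy_id_swap
    (G : C(I × Metric.sphere (0 : EuclideanSpace ℝ (Fin (n + 1))) 1,
      Metric.sphere (0 : EuclideanSpace ℝ (Fin (n + 1))) 1))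
    (h0 : ∀ v, G (0, v) = v) {a b : Fin n} (hab : a ≠ b)
    (h1 : ∀ v i, (G (1, v) : EuclideanSpace ℝ (Fin (n + 1))) i =
      (v : EuclideanSpace ℝ (Fin (n + 1))) (Equiv.swap a.succ b.succ i))
    (hG : ∀ v : Metric.sphere (0 : EuclideanSpace ℝ (Fin (n + 1))) 1, (v : EuclideanSpace ℝ (Fin (n + 1))) = EuclideanSpace.single 0 1 →
      ∀ t, G (t, v) = v) : False := by
  -- Coordinate 0 is the time, clamped to the unit interval so that `K` is defined everywhere; the
  -- others parametrize the sphere through the collapse.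
  let K : (Fin (n + 1) → ℝ) → Fin (n + 1) → ℝ := fun u =>
    WithLp.ofLp (G (Set.projIcc 0 1 zero_le_one (u 0), collapse fun i => u i.succ) :
      EuclideanSpace ℝ (Fin (n + 1)))
  have hK : Continuous K := by
    refine (PiLp.continuous_ofLp 2 _).comp (continuous_subtype_val.comp (G.continuous.comp ?_))
    exact (continuous_projIcc.comp (continuous_apply 0)).prodMk
      (continuous_collapse.comp (by fun_prop))
  have hKs : ∀ u, ∑ i, K u i ^ 2 = 1 := fun u => by
    have := norm_eq_of_mem_sphere (G (Set.projIcc 0 1 zero_le_one (u 0),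
      collapse fun i => u i.succ))
    rw [EuclideanSpace.norm_eq, Real.sqrt_eq_one] at this
    simpa using this
  -- The complements of the label regions pull back to an open cover, so a simplex of mesh below `δ`
  -- misses some label.
  obtain ⟨δ, hδ, hball⟩ := lebesgue_number_lemma_of_metric
    (s := Set.Icc (-1 : Fin (n + 1) → ℝ) 1) (c := fun o => K ⁻¹' (labelRegion o)ᶜ) isCompact_Icc
    (fun o => (isClosed_labelRegion o).isOpen_compl.preimage hK)
    (fun u _ => Set.mem_iUnion.2 (exists_notMem_labelRegion (hKs u)))
  have hc0 : collapseCoord (0 : Fin n → ℝ) 0 = -1 := by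
    simp [collapseCoord_zero, cubeBump]
  -- The centre of the cube goes to the antipode of the pole, so small simplices there avoid the
  -- exceptional label.
  have hnear : ∀ᶠ z in nhds (0 : Fin n → ℝ), collapseCoord z 0 < 1 / 2 := by
    refine ((continuous_apply 0).comp continuous_collapseCoord).continuousAt.eventually_lt
      continuousAt_const ?_
    change collapseCoord (0 : Fin n → ℝ) 0 < 1 / 2
    rw [hc0]; norm_num
  obtain ⟨ε, hε, hnear⟩ := Metric.eventually_nhds_iff.1 hnear
  obtain ⟨M', hM'⟩ := exists_nat_one_div_lt (lt_min hδ hε)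
  -- The bound 2 keeps the central simplex, whose coordinates are 0 or 1/`M`, off the walls.
  obtain ⟨M, hM2, hMδ, hMε⟩ : ∃ M : ℕ, 2 ≤ M ∧ 1 / (M : ℝ) < δ ∧ 1 / (M : ℝ) < ε := by
    refine ⟨M' + 2, by omega, ?_⟩
    rw [← lt_min_iff]
    refine lt_of_le_of_lt (one_div_le_one_div_of_le (by positivity) ?_) hM'
    push_cast
    linarith
  have hMpos : (0 : ℝ) < M := by exact_mod_cast (by omega : 0 < M)
  let L : (Fin (n + 1) → ℕ) → Option (Fin (n + 1)) := fun y => sphereLabel (K (gridPoint M y))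
  let Z : (Fin (n + 1) → ℕ) → Fin n → ℝ := fun y i => (y i.succ : ℝ) / M - 1
  have hKy : ∀ y, K (gridPoint M y) = WithLp.ofLp (G (Set.projIcc 0 1 zero_le_one
      ((y 0 : ℝ) / (2 * M : ℕ)), collapse (Z y)) : EuclideanSpace ℝ (Fin (n + 1))) := fun y => rfl
  have hK0 : ∀ y, y 0 = 0 → K (gridPoint M y) = collapseCoord (Z y) := fun y hy => by
    rw [hKy, hy, Nat.cast_zero, zero_div, Set.projIcc_left]
    exact congrArg (fun v : Metric.sphere (0 : EuclideanSpace ℝ (Fin (n + 1))) 1 =>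
      WithLp.ofLp (v : EuclideanSpace ℝ (Fin (n + 1)))) (h0 _)
  have hZsq : ∀ y : Fin (n + 1) → ℕ, (∀ i, y i ≤ 2 * M) → ∀ i, Z y i ^ 2 ≤ 1 := fun y hy i => by
    have := gridPoint_mem_Icc (by omega) hy
    rw [sq_le_one_iff_abs_le_one, abs_le]
    exact ⟨this.1 i.succ, this.2 i.succ⟩
  suffices h : ∃ x ∈ gridBox (n + 1) (2 * M), ∃ τ : Equiv.Perm (Fin (n + 1)),
      Function.Surjective fun j : Fin (n + 2) => L (kuhnVertex x τ j) by
    obtain ⟨x, hx, τ, hτ⟩ := h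
    have hxN := mem_gridBox.1 hx
    obtain ⟨o, ho⟩ := hball _ (gridPoint_mem_Icc (y := x) (by omega) fun i => (hxN i).le)
    obtain ⟨j, hj⟩ := hτ o
    have hmem := ho (Metric.mem_ball.2
      ((dist_gridPoint_kuhnVertex_le (by omega : 0 < M) x τ j).trans_lt hMδ))
    have hlab := mem_labelRegion_sphereLabel (K (gridPoint M (kuhnVertex x τ j)))
    have hj : sphereLabel (K (gridPoint M (kuhnVertex x τ j))) = o := hj
    rw [hj] at hlab
    exact hmem hlab
  refine exists_surjective_label (N := 2 * M) (M := M) (by omega) L ?_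
    (a := a.succ) (b := b.succ) (Fin.succ_ne_zero a) (Fin.succ_ne_zero b)
    (fun h => hab (Fin.succ_injective n h)) ?_ ?_ ?_
  · intro y hy i hi hyi
    obtain ⟨i, rfl⟩ := Fin.exists_succ_eq_of_ne_zero hi
    have hw : Z y i ^ 2 = 1 := by
      rcases hyi with h | h
      · simp [Z, h]
      · have : Z y i = 1 := by
          simp only [Z, h]
          push_cast
          field_simp
          norm_num
        rw [this, one_pow]
    have hpole : (collapse (Z y) : EuclideanSpace ℝ (Fin (n + 1))) = EuclideanSpace.single 0 1 := by
      ext k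
      rw [collapse_apply, collapseCoord_eq_of_wall hw]
      simp [Pi.single_apply]
    refine sphereLabel_eq_none ?_
    rw [hKy, hG _ hpole, hpole]
    norm_num
  · intro y hy hyN
    have e1 : K (gridPoint M y) = collapseCoord (Z y) ∘ Equiv.swap a.succ b.succ := by
      rw [hKy, hyN, div_self (by positivity), Set.projIcc_right]
      funext i
      exact h1 _ i
    have e2 : Z (fun i => if i = 0 then 0 else y (Equiv.swap a.succ b.succ i)) =
        Z y ∘ Equiv.swap a b := by
      funext i
      simp only [Z, Fin.succ_ne_zero, if_false, Function.comp_apply]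
      rw [(Fin.succ_injective n).map_swap]
    simp only [L]
    rw [e1, hK0 (fun i => if i = 0 then 0 else y (Equiv.swap a.succ b.succ i)) (if_pos rfl), e2,
      collapseCoord_comp_perm]
  · intro y hy hy0 j hj
    have hj : sphereLabel (K (gridPoint M y)) = some j := hj
    rw [hK0 y hy0, sphereLabel_eq_some_iff] at hj
    obtain ⟨hle, hlab⟩ := hj
    -- On a wall the zeroth coordinate would be 1 and the label exceptional. Off the walls the
    -- collapse preserves the positivity of coordinates.
    have hb : 0 < cubeBump (Z y) := by
      refine lt_of_le_of_ne (cubeBump_nonneg (hZsq y hy)) fun hb => ?_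
      have hd := (collapse_denom_pos (Z y)).ne'
      rw [collapseCoord_zero, ← hb] at hle
      rw [← hb] at hd
      simp only [ne_eq, OfNat.ofNat_ne_zero, not_false_eq_true, zero_pow, sub_zero,
        add_zero] at hd hle
      rw [div_self hd] at hle
      norm_num at hle
    have hpos : ∀ i, 0 < Z y i ↔ M < y i.succ := fun i => by
      simp only [Z]
      rw [sub_pos, one_lt_div hMpos, Nat.cast_lt]
    refine ⟨fun i hi => ?_, fun i hi => ?_⟩
    · rw [← hpos, ← collapseCoord_succ_pos hb]
      exact hlab.1 i hi
    · rw [← not_lt, ← hpos, ← collapseCoord_succ_pos hb, not_lt]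
      exact hlab.2 i hi
  · intro k
    simp only [L]
    rw [hK0 _ (if_pos rfl)]
    set z := Z fun i => if i = 0 then 0 else M + if i ≤ k then 1 else 0 with hz
    have hzi : ∀ i : Fin n, z i = if i.succ ≤ k then 1 / (M : ℝ) else 0 := fun i => by
      simp only [hz, Z, Fin.succ_ne_zero, if_false]
      split_ifs <;> push_cast <;> field_simp <;> ring
    have hM1 : 1 / (M : ℝ) < 1 := by
      rw [div_lt_one hMpos]
      exact_mod_cast hM2
    have hb : 0 < cubeBump z := Finset.prod_pos fun i _ => by
      rw [hzi]
      split_ifs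
      · have : 0 < 1 / (M : ℝ) := by positivity
        nlinarith
      · norm_num
    have hsmall : dist z 0 < ε := by
      refine lt_of_le_of_lt ((dist_pi_le_iff (by positivity)).2 fun i => ?_) hMε
      rw [hzi, Pi.zero_apply, Real.dist_eq, sub_zero]
      split_ifs
      · rw [abs_of_pos (by positivity)]
      · rw [abs_zero]; positivity
    refine sphereLabel_eq_some_iff.2 ⟨(hnear hsmall).le, fun i hi => ?_, fun i hi => ?_⟩
    · rw [collapseCoord_succ_pos hb, hzi, if_pos]
      · positivity
      · rw [Fin.le_def, Fin.val_succ]; omega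
    · rw [← not_lt, collapseCoord_succ_pos hb, hzi, if_neg]
      · exact lt_irrefl 0
      · rw [Fin.le_def, Fin.val_succ]; omega

end SwapNotHomotopic

/-! ### Lifting relative homotopies to the sphere, and normalizing a reflection to a coordinate
swap. -/

section EvenDimensional

open Module unitInterval

variable {E : Type*} [NormedAddCommGroup E] [InnerProductSpace ℝ E]

/-- A homotopy of self-maps of projective space from the identity to the map induced by an isometry
lifts to the sphere, provided that it fixes a point lying under a fixed point of the isometry. -/
theorem exists_sphere_homotopy_of_homotopicRel (hE : 1 < Module.rank ℝ E) (A : E ≃ₗᵢ[ℝ] E)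
    {v₀ : Metric.sphere (0 : E) 1} (hA : A v₀ = v₀)
    (h : (ContinuousMap.id (ℙ ℝ E)).HomotopicRel A.projectiveMap {sphereToProjective E v₀}) :
    ∃ G : C(I × Metric.sphere (0 : E) 1, Metric.sphere (0 : E) 1),
      (∀ v, G (0, v) = v) ∧ (∀ v, G (1, v) = A.sphereMap v) ∧ ∀ t, G (t, v₀) = v₀ := by
  have hconn : PreconnectedSpace (Metric.sphere (0 : E) 1) :=
    Subtype.preconnectedSpace (isPreconnected_sphere hE 0 1)
  obtain ⟨F⟩ := h
  have cov := isCoveringMap_sphereToProjective (E := E)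
  let H : C(I × Metric.sphere (0 : E) 1, ℙ ℝ E) :=
    ⟨fun q => F (q.1, sphereToProjective E q.2),
      F.continuous.comp (continuous_fst.prodMk (continuous_sphereToProjective.comp continuous_snd))⟩
  have H0 : ∀ v, H (0, v) = sphereToProjective E (ContinuousMap.id _ v) := fun v =>
    F.apply_zero _
  let G := cov.liftHomotopy H (ContinuousMap.id _) H0
  have hG : ∀ q, sphereToProjective E (G q) = H q := fun q =>
    congrFun (cov.liftHomotopy_lifts H (ContinuousMap.id _) H0) q
  have hG0 : ∀ v, G (0, v) = v := cov.liftHomotopy_zero H (ContinuousMap.id _) H0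
  -- This path lifts a constant path, hence is constant.
  have hfix : ∀ t, G (t, v₀) = v₀ := fun t => by
    have hcont : Continuous fun t : I => G (t, v₀) := by fun_prop
    rw [cov.const_of_comp hcont (fun s t => ?_) t 0, hG0]
    rw [hG, hG]
    exact (F.eq_fst s rfl).trans (F.eq_fst t rfl).symm
  refine ⟨G, hG0, fun v => ?_, hfix⟩
  have hcA : Continuous A.sphereMap :=
    (A.continuous.comp continuous_subtype_val).subtype_mk _
  -- Both maps lift the same map and agree at `v₀`; as the sphere is connected they coincide, which
  -- excludes the other lift `-A`.
  refine congrFun (cov.eq_of_comp_eq (g₁ := fun v => G (1, v)) (by fun_prop) hcA ?_ v₀ ?_) v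
  · funext v
    exact (hG _).trans (F.apply_one _)
  · exact (hfix 1).trans (Subtype.ext hA.symm)

theorem exists_orthonormalBasis_pair {n : ℕ} (hE : finrank ℝ E = n) [FiniteDimensional ℝ E]
    {i j : Fin n} (hij : i ≠ j) {u w : E} (hu : ‖u‖ = 1) (hw : ‖w‖ = 1) (huw : inner ℝ u w = 0) :
    ∃ b : OrthonormalBasis (Fin n) ℝ E, b i = u ∧ b j = w := by
  have hv : Orthonormal ℝ (({i, j} : Set (Fin n)).domRestrict fun k => if k = i then u else w) := by
    constructor
    · rintro ⟨k, rfl | rfl⟩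
      · simp [hu]
      · simp [hij.symm, hw]
    · rintro ⟨k, rfl | rfl⟩ ⟨l, rfl | rfl⟩ h
      · exact absurd rfl h
      · simpa [hij.symm] using huw
      · simpa [hij.symm, real_inner_comm] using huw
      · exact absurd rfl h
  obtain ⟨b, hb⟩ := hv.exists_orthonormalBasis_extension_of_card_eq (by simpa using hE)
  refine ⟨b, ?_, ?_⟩
  · rw [hb i (Or.inl rfl), if_pos rfl]
  · rw [hb j (Or.inr rfl), if_neg hij.symm]

theorem exists_isometry_map_pair {n : ℕ} (hE : finrank ℝ E = n) [FiniteDimensional ℝ E]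
    {i j : Fin n} (hij : i ≠ j) {u w u' w' : E} (hu : ‖u‖ = 1) (hw : ‖w‖ = 1)
    (huw : inner ℝ u w = 0) (hu' : ‖u'‖ = 1) (hw' : ‖w'‖ = 1) (huw' : inner ℝ u' w' = 0) :
    ∃ T : E ≃ₗᵢ[ℝ] E, T u = u' ∧ T w = w' := by
  obtain ⟨b, rfl, rfl⟩ := exists_orthonormalBasis_pair hE hij hu hw huw
  obtain ⟨b', rfl, rfl⟩ := exists_orthonormalBasis_pair hE hij hu' hw' huw'
  exact ⟨b.equiv b' (Equiv.refl _), by simp, by simp⟩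

theorem LinearIsometryEquiv.map_hyperplaneReflection (T : E ≃ₗᵢ[ℝ] E) (w v : E) :
    T (hyperplaneReflection w v) = hyperplaneReflection (T w) (T v) := by
  rw [hyperplaneReflection_apply, hyperplaneReflection_apply, map_sub, map_smul,
    LinearIsometryEquiv.inner_map_map, LinearIsometryEquiv.norm_map]

/-- The unit normal of the hyperplane on which two coordinates agree. -/
noncomputable def swapNormal {ι : Type*} [Fintype ι] [DecidableEq ι] (a b : ι) :
    EuclideanSpace ℝ ι :=
  (√2)⁻¹ • (EuclideanSpace.single a 1 - EuclideanSpace.single b 1)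

theorem inner_swapNormal {ι : Type*} [Fintype ι] [DecidableEq ι] (a b : ι)
    (v : EuclideanSpace ℝ ι) : inner ℝ (swapNormal a b) v = (√2)⁻¹ * (v a - v b) := by
  rw [swapNormal, inner_smul_left, inner_sub_left, EuclideanSpace.inner_single_left,
    EuclideanSpace.inner_single_left]
  simp

theorem norm_swapNormal {ι : Type*} [Fintype ι] [DecidableEq ι] {a b : ι} (hab : a ≠ b) :
    ‖swapNormal a b‖ = 1 := by
  have h2 : (√2)⁻¹ * (√2)⁻¹ = (1 / 2 : ℝ) := by
    rw [← mul_inv, Real.mul_self_sqrt zero_le_two, one_div]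
  have : ‖swapNormal a b‖ ^ 2 = 1 := by
    rw [← real_inner_self_eq_norm_sq, inner_swapNormal, swapNormal]
    simp [hab, hab.symm]
    linarith
  exact (pow_eq_one_iff_of_nonneg (norm_nonneg _) two_ne_zero).1 this

theorem hyperplaneReflection_swapNormal {ι : Type*} [Fintype ι] [DecidableEq ι] {a b : ι}
    (hab : a ≠ b) (v : EuclideanSpace ℝ ι) (i : ι) :
    hyperplaneReflection (swapNormal a b) v i = v (Equiv.swap a b i) := by
  have h2 : (√2)⁻¹ * (√2)⁻¹ = (1 / 2 : ℝ) := by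
    rw [← mul_inv, Real.mul_self_sqrt zero_le_two, one_div]
  have key : hyperplaneReflection (swapNormal a b) v i =
      v i - (v a - v b) * ((if i = a then 1 else 0) - if i = b then 1 else 0) := by
    rw [hyperplaneReflection_apply, norm_swapNormal hab, inner_swapNormal]
    simp only [swapNormal, PiLp.sub_apply, PiLp.smul_apply, smul_eq_mul, PiLp.single_apply]
    linear_combination (-2 * (v a - v b) * ((if i = a then 1 else 0) - if i = b then 1 else 0)) * h2
  rw [key]
  rcases eq_or_ne i a with rfl | ha
  · rw [Equiv.swap_apply_left]; simp [hab]
  rcases eq_or_ne i b with rfl | hb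
  · rw [Equiv.swap_apply_right]; simp [ha]
  rw [Equiv.swap_apply_of_ne_of_ne ha hb]
  simp [ha, hb]

/-- A reflection of a projective space of dimension at least two is not homotopic to the identity
relative to a point of the mirror. -/
theorem not_homotopicRel_id_reflection {n : ℕ} (hn : 2 ≤ n)
    (v₀ : Metric.sphere (0 : EuclideanSpace ℝ (Fin (n + 1))) 1) {e : EuclideanSpace ℝ (Fin (n + 1))}
    (he : ‖e‖ = 1) (hve : inner ℝ e (v₀ : EuclideanSpace ℝ (Fin (n + 1))) = 0) :
    ¬ (ContinuousMap.id (ℙ ℝ (EuclideanSpace ℝ (Fin (n + 1))))).HomotopicRel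
      (hyperplaneReflection e).projectiveMap {sphereToProjective _ v₀} := by
  intro h
  have hrank : 1 < Module.rank ℝ (EuclideanSpace ℝ (Fin (n + 1))) := by
    rw [← Module.finrank_eq_rank, finrank_euclideanSpace_fin]
    exact_mod_cast (by omega : 1 < n + 1)
  obtain ⟨G, hG0, hG1, hGfix⟩ := exists_sphere_homotopy_of_homotopicRel hrank _
    (hyperplaneReflection_of_inner_eq_zero hve) h
  let a : Fin n := ⟨0, by omega⟩
  let b : Fin n := ⟨1, by omega⟩
  have hab : a ≠ b := by simp [a, b]
  have hab' : a.succ ≠ b.succ := fun h => hab (Fin.succ_injective n h)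
  -- Conjugation by `T` moves the base point to the pole and turns the reflection into a swap of two
  -- other coordinates, which exist since `n` is at least 2.
  obtain ⟨T, hTv, hTe⟩ := exists_isometry_map_pair (finrank_euclideanSpace_fin (𝕜 := ℝ)) hab'
    (norm_eq_of_mem_sphere v₀) he (by rwa [real_inner_comm])
    (u' := EuclideanSpace.single (0 : Fin (n + 1)) (1 : ℝ)) (by simp) (norm_swapNormal hab')
    (by rw [real_inner_comm, inner_swapNormal]; simp [Fin.succ_ne_zero])
  have hcT : ∀ A : EuclideanSpace ℝ (Fin (n + 1)) ≃ₗᵢ[ℝ] EuclideanSpace ℝ (Fin (n + 1)),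
      Continuous A.sphereMap := fun A => (A.continuous.comp continuous_subtype_val).subtype_mk _
  have hTT : ∀ v, T.sphereMap (T.symm.sphereMap v) = v := fun v =>
    Subtype.ext (T.apply_symm_apply _)
  refine not_homotopy_id_swap ⟨fun q => T.sphereMap (G (q.1, T.symm.sphereMap q.2)),
    (hcT T).comp (G.continuous.comp (continuous_fst.prodMk ((hcT T.symm).comp continuous_snd)))⟩
    (fun v => ?_) hab (fun v i => ?_) fun v hv t => ?_
  · change T.sphereMap (G (0, T.symm.sphereMap v)) = v
    rw [hG0, hTT]
  · change (T.sphereMap (G (1, T.symm.sphereMap v)) : EuclideanSpace ℝ (Fin (n + 1))) i = _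
    rw [hG1, ← hyperplaneReflection_swapNormal hab', ← hTe]
    change T (hyperplaneReflection e (T.symm v)) i = _
    rw [T.map_hyperplaneReflection, T.apply_symm_apply]
  · change T.sphereMap (G (t, T.symm.sphereMap v)) = v
    have : T.symm.sphereMap v = v₀ := Subtype.ext (by
      change T.symm v = v₀
      rw [hv, ← hTv, T.symm_apply_apply])
    rw [this, hGfix, ← this, hTT]

end EvenDimensional

theorem mainTheorem10 (n : ℕ) (hn : n ≠ 0) :
    (Odd n →
      ∀ (f g : C(RealProjectiveSpace n, RealProjectiveSpace n)) (a : RealProjectiveSpace n),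
        f.Homotopic g → f a = g a → f.HomotopicRel g {a}) ∧
    (Even n →
      ∀ a ∈ RealProjectiveSpace.hyperplane n,
        ∃ f g : C(RealProjectiveSpace n, RealProjectiveSpace n),
          Set.EqOn f g (RealProjectiveSpace.hyperplane n) ∧
          f.Homotopic g ∧
          ¬ f.HomotopicRel g {a}) := by
  have hrank : Module.finrank ℝ (EuclideanSpace ℝ (Fin (n + 1))) = n + 1 :=
    finrank_euclideanSpace_fin
  constructor
  · intro hodd f g a h ha
    refine h.homotopicRel_of_even_finrank ?_ a ha
    rw [hrank]
    exact hodd.add_one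
  · intro heven a ha
    let e : EuclideanSpace ℝ (Fin (n + 1)) := EuclideanSpace.single (Fin.last n) 1
    have he : ‖e‖ = 1 := by simp [e]
    have he0 : e ≠ 0 := norm_ne_zero_iff.1 (by rw [he]; exact one_ne_zero)
    have hinner : ∀ v, sphereToProjective _ v ∈ RealProjectiveSpace.hyperplane n →
        inner ℝ e (v : EuclideanSpace ℝ (Fin (n + 1))) = 0 := fun v hv => by
      have := (RealProjectiveSpace.mk_mem_hyperplane _ (ne_zero_of_mem_unit_sphere v)).1 hv
      rw [EuclideanSpace.inner_single_left, this, mul_zero]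
    refine ⟨ContinuousMap.id _, (hyperplaneReflection e).projectiveMap, ?_, ?_, ?_⟩
    · intro p hp
      obtain ⟨v, rfl⟩ := exists_sphereToProjective_eq p
      rw [LinearIsometryEquiv.projectiveMap_sphereToProjective, ContinuousMap.id_apply]
      exact congrArg _ (Subtype.ext (hyperplaneReflection_of_inner_eq_zero (hinner v hp)).symm)
    -- The negative of the reflection fixes `e` and has determinant 1 in odd dimension `n + 1`; the
    -- resulting homotopy is relative to the line of `e`, not to `a`.
    · rw [← LinearIsometryEquiv.projectiveMap_neg]
      refine (projectiveMap_homotopicRel_id he0 _ ?_ ?_).homotopic.symm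
      · rw [LinearIsometryEquiv.mul_apply,
          Submodule.reflection_orthogonalComplement_singleton_eq_neg]
        exact neg_neg e
      · rw [LinearIsometryEquiv.detReal_mul, LinearIsometryEquiv.detReal_neg,
          detReal_hyperplaneReflection he0, hrank, heven.add_one.neg_one_pow]
        norm_num
    · obtain ⟨v, rfl⟩ := exists_sphereToProjective_eq a
      exact not_homotopicRel_id_reflection (by obtain ⟨k, rfl⟩ := heven; omega) v he (hinner v ha)
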